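/- **Theorem (consistency and asymptotic normality).** *Setting.* Units $i=1,2,\dots$ are observed in periods $1,\dots,\mathcal T$ ($\mathcal T$ fixed) on a probability space. $D_{it}\in\{0,1\}$ is unit $i$'s treatment status, $D_{i1}=0$, and $D_{i,t-1}=1\Rightarrow D_{it}=1$ (staggered adoption). The group of unit $i$ is $G_i:=\min\{t: D_{it}=1\}$, with $G_i:=\infty$ if unit $i$ is never treated. $Y_{it}(g)$ is the potential outcome of unit $i$ in period $t$ if it were in group $g$, $Y_{it}(0):=Y_{it}(\infty)$ is the untreated potential outcome, and $Y_{it}=Y_{it}(G_i)$ is observed. Expectations of variables without unit index refer to a representative unit. Let $p_g:=P(G=g)$, $\mathcal G:=\{g\in\{2,\dots,\mathcal T,\infty\}:p_g>0\}$, $\mathcal G^{comp}(g,t):=\{g'\in\mathcal G: t<g'\}$, and let $t^{max}(g)$ be the largest $t\in\{1,\dots,\mathcal T\}$ with $|\mathcal G^{comp}(g,t)|\ge R+1$. Let $\mathcal G^\dagger:=\{g\in\mathcal G: R+2\le g\le t^{max}(g)\}$ and $ATT(g,t):=E[Y_t(g)-Y_t(0)\mid G=g]$. *Assumptions.* Fix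 $g\in\mathcal G^\dagger$ and $t\in\{g,\dots,t^{max}(g)\}$. 1. (No anticipation) $Y_{is}=Y_{is}(0)$ for all $s<G_i$. 2. (Sampling) The observed data $(Y_{i1},\dots,Y_{i\mathcal T},G_i)$ are iid across $i$. 3. (Interactive fixed effects) $Y_{is}(0)=\theta_s+\eta_i+\lambda_i'F_s+e_{is}$ for $s=1,\dots,\mathcal T$, with fixed $\theta_s\in\mathbb R$, $F_s\in\mathbb R^R$, random $\eta_i\in\mathbb R$, $\lambda_i\in\mathbb R^R$, and errors with $E[e_s\mid\eta,\lambda]=0$ a.s. 4. (Unconfoundedness) $E[Y_s(0)\mid\eta,\lambda,G]=E[Y_s(0)\mid\eta,\lambda]$ a.s. for $s=1,\dots,\mathcal T$. Here and above $Y_s(0)$, $\lambda$ and $e_s$ are integrable. 5. (Factor rank) $\operatorname{rank}\Delta F^{pre}=R$, where $\Delta F^{pre}$ is the $(g-2)\times R$ matrix with rows $(F_s-F_{s-1})'$, $s=2,\dots,g-1$. 6. (Loading rank) $\operatorname{rank}E[\ell^{comp}\,(1,\lambda')]=R+1$, where $\ell_i^{comp}$ is the vector $\big(\mathbf 1\{G_i=g'\}/p_{g'}\big)_{g'\in\mathcal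 G^{comp}(g,t)}$. 7. $E\|(Y_1,\dots,Y_{\mathcal T})'\|^4<\infty$, and $\widehat W\xrightarrow{p}W$, where $W$ is a positive definite $|\mathcal G^{comp}(g,t)|\times|\mathcal G^{comp}(g,t)|$ matrix and the $\widehat W=\widehat W_n$ are random matrices of the same size. *Parameters.* Let $\Omega$ be a known $(g-2)\times R$ matrix with $\operatorname{rank}\Omega=R$ and $\operatorname{rank}(\Omega'\Delta F^{pre})=\operatorname{rank}\Delta F^{pre}$, and let $H:=(\Omega'\Delta F^{pre})^{-1}\Omega'$. For a sequence $x_1,\dots,x_{\mathcal T}$ of scalars write $\Delta x^{pre}:=(x_2-x_1,\dots,x_{g-1}-x_{g-2})'$. Put $$\theta^*:=(\theta_t-\theta_{g-1})-(F_t-F_{g-1})'H\Delta\theta^{pre},\qquad F^*:=\big((F_t-F_{g-1})'(\Omega'\Delta F^{pre})^{-1}\big)',\qquad \delta^*:=(\theta^*,F^{*\prime})',$$ $$v_i:=(e_{it}-e_{i,g-1})-(F_t-F_{g-1})'H\Delta e_i^{pre},\qquad X_i:=\big(1,(\Omega'\Delta Y_i^{pre})'\big)',\qquad A_i:=\mathbf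 1\{G_i=g\}X_i,$$ $$\Gamma:=E[\ell^{comp}X'],\qquad B:=(\Gamma'W\Gamma)^{-1}\Gamma'W .$$ *Estimator.* With $E_n$ the average over $i=1,\dots,n$, put $\widehat p_g:=E_n[\mathbf 1\{G_i=g\}]$, $\widehat\Gamma:=E_n[\ell_i^{comp}X_i']$, $$\widehat\delta^*:=(\widehat\Gamma'\widehat W\widehat\Gamma)^{-1}\widehat\Gamma'\widehat W\,E_n[\ell_i^{comp}(Y_{it}-Y_{i,g-1})],$$ $$\widehat{ATT}(g,t):=\widehat p_g^{-1}\Big\{E_n\big[\mathbf 1\{G_i=g\}(Y_{it}-Y_{i,g-1})\big]-E_n[A_i]'\widehat\delta^*\Big\},$$ with an arbitrary convention where an inverse does not exist, an event of probability tending to $0$. (In the formal statement, the inverse of $0$ and of a singular matrix is $0$.) *Influence function.* $$\psi_{igt}:=\frac{\mathbf 1\{G_i=g\}(Y_{it}-Y_{i,g-1})-E[\mathbf 1\{G=g\}(Y_t-Y_{g-1})]}{p_g}-\frac{E[A]'}{p_g}B\,\ell_i^{comp}v_i-\frac{\delta^{*\prime}}{p_g}(A_i-E[A])-\frac{ATT(g,t)}{p_g}(\mathbf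 1\{G_i=g\}-p_g).$$ *Conclusion.* $E[\psi_{igt}]=0$, $E[\psi_{igt}^2]<\infty$, and as $n\to\infty$: (i) $\sqrt n\,(\widehat{ATT}(g,t)-ATT(g,t))=\frac1{\sqrt n}\sum_{i=1}^n\psi_{igt}+o_p(1)$; (ii) $\widehat{ATT}(g,t)\xrightarrow{p}ATT(g,t)$; (iii) $\sqrt n\,(\widehat{ATT}(g,t)-ATT(g,t))\xrightarrow{d}N(0,\sigma_{gt}^2)$ with $\sigma_{gt}^2=E[\psi_{igt}^2]$. -/

import Mathlib

open MeasureTheory ProbabilityTheory Filter Topology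
open scoped Matrix ENNReal

noncomputable section

/-- An infinite sequence of units `i = 0, 1, 2, …` observed over the periods `1, …, T`, with the
random variables and parameters of an interactive fixed effects model with `R` factors.
A sample of size `n` consists of the units `i < n`. Population quantities, which carry no unit
index, are those of the representative unit `0`. Values at periods outside `1, …, T` are never
used. -/
structure IFEPanel (Ω : Type*) [MeasurableSpace Ω] (R T : ℕ) where
  /-- `D i t`: unit `i` is treated in period `t`. -/
  D : ℕ → ℕ → Ω → Bool
  /-- `Ypot i g t`: potential outcome of unit `i` in period `t`, had it been in group `g`;
  the group `⊤` is "never treated". -/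
  Ypot : ℕ → ℕ∞ → ℕ → Ω → ℝ
  /-- unit fixed effects -/
  η : ℕ → Ω → ℝ
  /-- factor loadings -/
  lam : ℕ → Ω → Fin R → ℝ
  /-- idiosyncratic errors -/
  e : ℕ → ℕ → Ω → ℝ
  /-- time fixed effects -/
  θ : ℕ → ℝ
  /-- factors -/
  F : ℕ → Fin R → ℝ
  measurable_D : ∀ i t, Measurable (D i t)
  measurable_Ypot : ∀ i g t, Measurable (Ypot i g t)
  measurable_η : ∀ i, Measurable (η i)
  measurable_lam : ∀ i, Measurable (lam i)
  measurable_e : ∀ i t, Measurable (e i t)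

namespace IFEPanel

variable {Ω : Type*} [MeasurableSpace Ω] {R T : ℕ} (S : IFEPanel Ω R T) (μ : Measure Ω)

/-! ### Groups and outcomes -/

/-- The group of unit `i`: its first treated period, `⊤` if it is never treated. -/
def G (i : ℕ) (ω : Ω) : ℕ∞ :=
  sInf {x : ℕ∞ | ∃ t ∈ Finset.Icc 1 T, S.D i t ω = true ∧ x = (t : ℕ∞)}

/-- Untreated potential outcome `Y_{it}(0)`. -/
def Y0 (i t : ℕ) (ω : Ω) : ℝ := S.Ypot i ⊤ t ω

/-- Observed outcome `Y_{it} = Y_{it}(G_i)`. -/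
def Y (i t : ℕ) (ω : Ω) : ℝ := S.Ypot i (S.G i ω) t ω

/-- The vector `(Y_{i1}, …, Y_{iT})`. -/
def Yvec (i : ℕ) (ω : Ω) : EuclideanSpace ℝ (Fin T) :=
  WithLp.toLp 2 fun k => S.Y i (k + 1) ω

/-- The observed data `(Y_{i1}, …, Y_{iT}, G_i)` of unit `i`. -/
def obs (i : ℕ) (ω : Ω) : EuclideanSpace ℝ (Fin T) × ℕ∞ := (S.Yvec i ω, S.G i ω)

/-- `1{G_i = g}`. -/
def ind (g : ℕ∞) (i : ℕ) (ω : Ω) : ℝ := if S.G i ω = g then 1 else 0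

/-- `p_g = P(G = g)`. -/
def p (g : ℕ∞) : ℝ := μ.real {ω | S.G 0 ω = g}

open Classical in
/-- The set of groups: the elements of `{2, …, T, ∞}` of positive probability. -/
def groups : Finset ℕ∞ :=
  (insert ⊤ ((Finset.Icc 2 T).image (fun t : ℕ => (t : ℕ∞)))).filter fun g => 0 < S.p μ g

open Classical in
/-- `𝒢^comp(g,t)`: the groups not yet treated by period `t` (they do not depend on `g`). -/
def comp (t : ℕ) : Finset ℕ∞ := (S.groups μ).filter fun g' => (t : ℕ∞) < g'

open Classical in
/-- `t^max(g)`: the last period `t` with `|𝒢^comp(g,t)| ≥ R + 1` (`0` if there is none). -/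
def tMax : ℕ := ((Finset.Icc 1 T).filter fun t => R + 1 ≤ (S.comp μ t).card).sup id

open Classical in
/-- `𝒢† = {g ∈ 𝒢 : R + 2 ≤ g ≤ t^max(g)}`. -/
def groupsDagger : Finset ℕ∞ :=
  (S.groups μ).filter fun g => ((R + 2 : ℕ) : ℕ∞) ≤ g ∧ g ≤ ((S.tMax μ : ℕ) : ℕ∞)

/-- `ATT(g,t) = E[Y_t(g) - Y_t(0) | G = g]`. -/
def ATT (g t : ℕ) : ℝ :=
  ∫ ω, (S.Ypot 0 g t ω - S.Y0 0 t ω) ∂(ProbabilityTheory.cond μ {ω | S.G 0 ω = (g : ℕ∞)})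

/-! ### Assumptions -/

/-- Staggered adoption; units already treated in the first period have been dropped. -/
def StaggeredAdoption : Prop :=
  ∀ i, ∀ᵐ ω ∂μ, S.D i 1 ω = false ∧
    ∀ t ∈ Finset.Icc 2 T, S.D i (t - 1) ω = true → S.D i t ω = true

def NoAnticipation : Prop :=
  ∀ i, ∀ᵐ ω ∂μ, ∀ t ∈ Finset.Icc 1 T, (t : ℕ∞) < S.G i ω → S.Y i t ω = S.Y0 i t ω

/-- The observed data are iid across units. -/
def IIDSampling : Prop :=
  iIndepFun S.obs μ ∧ ∀ i, IdentDistrib (S.obs i) (S.obs 0) μ μ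

/-- The σ-algebra generated by `(η, λ)`. -/
abbrev sigmaHet : MeasurableSpace Ω :=
  MeasurableSpace.comap (fun ω => (S.η 0 ω, S.lam 0 ω)) inferInstance

/-- The σ-algebra generated by `(η, λ, G)`. -/
abbrev sigmaHetG : MeasurableSpace Ω :=
  MeasurableSpace.comap (fun ω => (S.η 0 ω, S.lam 0 ω, S.G 0 ω)) inferInstance

/-- Interactive fixed effects model `Y_{it}(0) = θ_t + η_i + λ_i'F_t + e_{it}`, where the errors
are integrable and satisfy `E[e_t | η, λ] = 0`. -/
def IFEModel : Prop :=
  (∀ i, ∀ᵐ ω ∂μ, ∀ t ∈ Finset.Icc 1 T,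
    S.Y0 i t ω = S.θ t + S.η i ω + S.lam i ω ⬝ᵥ S.F t + S.e i t ω) ∧
  ∀ t ∈ Finset.Icc 1 T, Integrable (S.e 0 t) μ ∧ μ[S.e 0 t | S.sigmaHet] =ᵐ[μ] 0

/-- Unconfoundedness: `E[Y_t(0) | η, λ, G] = E[Y_t(0) | η, λ]` almost surely. -/
def Unconfoundedness : Prop :=
  ∀ t ∈ Finset.Icc 1 T, Integrable (S.Y0 0 t) μ ∧
    μ[S.Y0 0 t | S.sigmaHetG] =ᵐ[μ] μ[S.Y0 0 t | S.sigmaHet]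

/-- The matrix with rows `ΔF_s' = (F_s - F_{s-1})'`, `s = 2, …, g - 1`. -/
def ΔFpre (g : ℕ) : Matrix (Fin (g - 2)) (Fin R) ℝ :=
  Matrix.of fun k r => S.F (k + 2) r - S.F (k + 1) r

def RankFactors (g : ℕ) : Prop := (S.ΔFpre g).rank = R

/-- `ℓ_i^comp(g,t)`, with entries `1{G_i = g'} / p_{g'}`. -/
def ell (t i : ℕ) (ω : Ω) (g' : S.comp μ t) : ℝ := S.ind g' i ω / S.p μ g'

/-- `Λ^comp(g,t) = E[ℓ^comp(g,t) (1, λ')]`. -/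
def LambdaComp (t : ℕ) : Matrix (S.comp μ t) (Fin (R + 1)) ℝ :=
  Matrix.of fun g' j => ∫ ω, S.ell μ t 0 ω g' * (Fin.cons 1 (S.lam 0 ω) : Fin (R + 1) → ℝ) j ∂μ

def RankLoadings (t : ℕ) : Prop :=
  (∀ r, Integrable (fun ω => S.lam 0 ω r) μ) ∧ (S.LambdaComp μ t).rank = R + 1

/-- `E‖Y‖⁴ < ∞`. -/
def FiniteFourthMoment : Prop := Integrable (fun ω => ‖S.Yvec 0 ω‖ ^ 4) μ

/-! ### The parameters of the estimating equation

`Om` is the known `(g-2) × R` matrix that reduces the pre-treatment differences to `R` regressors.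
-/

variable {g : ℕ} (Om : Matrix (Fin (g - 2)) (Fin R) ℝ)

/-- `Om` has rank `R` and `rank (Om' ΔF^pre) = rank ΔF^pre`. -/
def AdmissibleOm : Prop := Om.rank = R ∧ (Omᵀ * S.ΔFpre g).rank = (S.ΔFpre g).rank

/-- `H^pre(g) = (Om' ΔF^pre)⁻¹ Om'`. -/
def Hpre : Matrix (Fin R) (Fin (g - 2)) ℝ := (Omᵀ * S.ΔFpre g)⁻¹ * Omᵀ

/-- `(θ_t - θ_{g-1}) - (F_t - F_{g-1})' H^pre Δθ^pre`. -/
def thetaStar (t : ℕ) : ℝ :=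
  (S.θ t - S.θ (g - 1)) -
    (S.F t - S.F (g - 1)) ⬝ᵥ (S.Hpre Om *ᵥ fun k => S.θ (k + 2) - S.θ (k + 1))

/-- `((F_t - F_{g-1})' (Om' ΔF^pre)⁻¹)'`. -/
def FStar (t : ℕ) : Fin R → ℝ := (S.F t - S.F (g - 1)) ᵥ* (Omᵀ * S.ΔFpre g)⁻¹

/-- `δ*(g,t) = (θ*(g,t), F*(g,t)')'`. -/
def deltaStar (t : ℕ) : Fin (R + 1) → ℝ := Fin.cons (S.thetaStar Om t) (S.FStar Om t)

/-- `v_i(g,t) = (e_{it} - e_{i,g-1}) - (F_t - F_{g-1})' H^pre Δe_i^pre`. -/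
def v (t i : ℕ) (ω : Ω) : ℝ :=
  (S.e i t ω - S.e i (g - 1) ω) -
    (S.F t - S.F (g - 1)) ⬝ᵥ (S.Hpre Om *ᵥ fun k => S.e i (k + 2) ω - S.e i (k + 1) ω)

/-- `(1, (Om' ΔY_i^pre)')'`, where `ΔY_i^pre` has the entries `Y_{is} - Y_{i,s-1}`,
`s = 2, …, g - 1`. -/
def regressor (i : ℕ) (ω : Ω) : Fin (R + 1) → ℝ :=
  Fin.cons 1 (Omᵀ *ᵥ fun k => S.Y i (k + 2) ω - S.Y i (k + 1) ω)

/-- `A_i(g) = 1{G_i = g} (1, (Om' ΔY_i^pre)')'`. -/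
def A (i : ℕ) (ω : Ω) : Fin (R + 1) → ℝ := S.ind g i ω • S.regressor Om i ω

/-- `E[A(g)]`. -/
def EA : Fin (R + 1) → ℝ := fun j => ∫ ω, S.A Om 0 ω j ∂μ

/-- `Γ(g,t) = E[ℓ^comp(g,t) (1, (Om' ΔY^pre)')]`. -/
def Gam (t : ℕ) : Matrix (S.comp μ t) (Fin (R + 1)) ℝ :=
  Matrix.of fun g' j => ∫ ω, S.ell μ t 0 ω g' * S.regressor Om 0 ω j ∂μ

/-- `B(g,t) = (Γ' W Γ)⁻¹ Γ' W`. -/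
def B (t : ℕ) (W : Matrix (S.comp μ t) (S.comp μ t) ℝ) :
    Matrix (Fin (R + 1)) (S.comp μ t) ℝ :=
  ((S.Gam μ Om t)ᵀ * W * S.Gam μ Om t)⁻¹ * (S.Gam μ Om t)ᵀ * W

/-! ### The estimator -/

/-- Sample average `E_n` over the units `i < n`. -/
def sampleMean (n : ℕ) (f : ℕ → Ω → ℝ) (ω : Ω) : ℝ := (n : ℝ)⁻¹ * ∑ i ∈ Finset.range n, f i ω

/-- `Γ̂(g,t)`. -/
def GamHat (t n : ℕ) (ω : Ω) : Matrix (S.comp μ t) (Fin (R + 1)) ℝ :=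
  Matrix.of fun g' j =>
    sampleMean n (fun i ω => S.ell μ t i ω g' * S.regressor Om i ω j) ω

/-- `δ̂*(g,t) = (Γ̂' Ŵ Γ̂)⁻¹ Γ̂' Ŵ E_n[ℓ_i^comp(g,t) (Y_{it} - Y_{i,g-1})]`. -/
def deltaHat (t : ℕ) (What : ℕ → Ω → Matrix (S.comp μ t) (S.comp μ t) ℝ) (n : ℕ) (ω : Ω) :
    Fin (R + 1) → ℝ :=
  (((S.GamHat μ Om t n ω)ᵀ * What n ω * S.GamHat μ Om t n ω)⁻¹ *
      (S.GamHat μ Om t n ω)ᵀ * What n ω) *ᵥ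
    fun g' => sampleMean n (fun i ω => S.ell μ t i ω g' * (S.Y i t ω - S.Y i (g - 1) ω)) ω

/-- The plug-in GMM estimator of `ATT(g,t)` from a sample of size `n`:
`p̂_g⁻¹ {E_n[1{G_i = g} (Y_{it} - Y_{i,g-1})] - E_n[A_i(g)]' δ̂*(g,t)}`. -/
def ATTHat (t : ℕ) (What : ℕ → Ω → Matrix (S.comp μ t) (S.comp μ t) ℝ) (n : ℕ) (ω : Ω) : ℝ :=
  (sampleMean n (S.ind g) ω)⁻¹ *
    (sampleMean n (fun i ω => S.ind g i ω * (S.Y i t ω - S.Y i (g - 1) ω)) ω -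
      (fun j => sampleMean n (fun i ω => S.A Om i ω j) ω) ⬝ᵥ S.deltaHat μ Om t What n ω)

/-! ### The influence function -/

variable (g) in
def psi1 (t i : ℕ) (ω : Ω) : ℝ :=
  (S.ind g i ω * (S.Y i t ω - S.Y i (g - 1) ω) -
    ∫ ω', S.ind g 0 ω' * (S.Y 0 t ω' - S.Y 0 (g - 1) ω') ∂μ) / S.p μ g

def psi2 (t : ℕ) (W : Matrix (S.comp μ t) (S.comp μ t) ℝ) (i : ℕ) (ω : Ω) : ℝ :=
  -(((S.p μ g)⁻¹ • S.EA μ Om) ⬝ᵥ (S.B μ Om t W *ᵥ fun g' => S.ell μ t i ω g' * S.v Om t i ω))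

def psi3 (t i : ℕ) (ω : Ω) : ℝ :=
  -(((S.p μ g)⁻¹ • S.deltaStar Om t) ⬝ᵥ (S.A Om i ω - S.EA μ Om))

variable (g) in
def psi4 (t i : ℕ) (ω : Ω) : ℝ := -(S.ATT μ g t / S.p μ g * (S.ind g i ω - S.p μ g))

/-- The influence function `ψ_{igt}`. -/
def psi (t : ℕ) (W : Matrix (S.comp μ t) (S.comp μ t) ℝ) (i : ℕ) (ω : Ω) : ℝ :=
  S.psi1 μ g t i ω + S.psi2 μ Om t W i ω + S.psi3 μ Om t i ω + S.psi4 μ g t i ω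

end IFEPanel

end

/-!
Let `H = (Om' ΔF)⁻¹ Om'`, which exists by the rank conditions on the factors. For a unit untreated
before `g`, the pre-treatment differences can be solved for its loadings,
`λ = H (ΔY - Δθ - Δe)`, and substituting this into the untreated outcome gives the
quasi-differenced equation `Y_t(0) - Y_{g-1} = X'δ* + v` (`ae_Y0_sub_Y`), which is free of `η` and
`λ`. Unconfoundedness, after subtraction of the `(η, λ)`-measurable part of `Y_s(0)`, says
`E[e_s | η, λ, G] = 0`, so that `v` has mean zero in every group (`isGroupMeanZero_v`). Three facts
follow.

* In group `g` the equation identifies the effect: `p_g ATT = E[1{G = g}(Y_t - Y_{g-1})] - E[A]'δ*`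
  (`p_mul_ATT`).
* In the comparison groups `Y_t` is untreated, so `E[ℓ(Y_t - Y_{g-1})] = Γ δ*`, and `Γ` equals
  `Λ^comp` times an invertible matrix. Hence `Γ` is injective (`Gam_mulVec_injective`) and
  `Γ'WΓ` is positive definite.
* The first fact cancels the centring constants of the influence function, leaving
  `p_g ψ = 1{G = g}(Y_t - Y_{g-1}) - E[A]'B ℓ v - δ*'A - ATT 1{G = g}` (`psi_eq`).

With probability tending to one, `δ̂* = δ* + B̂ E_n[ℓ v]` (`ae_deltaHat_eq`), where `B̂` is the
sample analogue of `B`, and then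
`√n (ATT̂ - ATT) - n^{-1/2} ∑ ψ_i` is exactly
`(p_g / p̂_g - 1) n^{-1/2} ∑ ψ_i + p̂_g⁻¹ (E[A]'B - E_n[A]'B̂) n^{-1/2} ∑ ℓ_i v_i`.
The coefficients are `o_p(1)` by the law of large numbers and continuity, and the normalized sums
are bounded in probability by Chebyshev's inequality (`tendsto_mul_normalizedSum`), which proves
asymptotic linearity (`tendsto_sqrt_mul_ATTHat_sub`). Consistency follows on division by `√n`, and
asymptotic normality from the central limit theorem and Slutsky's theorem. The errors are not
observed, but `ℓ v = ℓ (Y_t - Y_{g-1} - X'δ*)` almost surely, so `ψ` is a square integrable function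
of the iid observed data.

Convergence in probability is handled as convergence along a filter on `ℕ × Ω`, `probFilter`, so
that the continuous mapping theorem and arguments on events of probability tending to one are
instances of the calculus of filters.
-/

/-! ### Convergence in probability as convergence along a filter -/

section ProbFilter

variable {Ω : Type*} [MeasurableSpace Ω] {μ : Measure Ω}

/-- The filter on `ℕ × Ω` of the sets `s` whose `n`-th section fails with `μ`-measure tending to
`0`. Convergence along it to a constant is convergence in probability
(`tendstoInMeasure_const_iff`), and a property holds eventually along it iff it holds with
probability tending to one. No measurability is needed, because `μ` is used as an outer measure. -/
def probFilter (μ : Measure Ω) : Filter (ℕ × Ω) where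
  sets := {s | Tendsto (fun n => μ {ω | (n, ω) ∉ s}) atTop (𝓝 0)}
  univ_sets := by simp
  sets_of_superset {s t} hs hst := by
    refine tendsto_of_tendsto_of_tendsto_of_le_of_le tendsto_const_nhds hs
      (fun _ => zero_le) fun n => measure_mono fun ω hω h => hω (hst h)
  inter_sets {s t} hs ht := by
    have h := Tendsto.add hs ht
    rw [add_zero] at h
    refine tendsto_of_tendsto_of_tendsto_of_le_of_le tendsto_const_nhds h
      (fun _ => zero_le) fun n => ?_
    refine (measure_mono fun ω hω => ?_).trans (measure_union_le _ _)
    by_cases h : (n, ω) ∈ s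
    · exact Or.inr fun h' => hω ⟨h, h'⟩
    · exact Or.inl h

lemma eventually_probFilter_iff {P : ℕ × Ω → Prop} :
    (∀ᶠ x in probFilter μ, P x) ↔ Tendsto (fun n => μ {ω | ¬ P (n, ω)}) atTop (𝓝 0) := Iff.rfl

lemma tendstoInMeasure_const_iff {E : Type*} [PseudoEMetricSpace E] {f : ℕ → Ω → E} {c : E} :
    TendstoInMeasure μ f atTop (fun _ => c) ↔
      Tendsto (fun x : ℕ × Ω => f x.1 x.2) (probFilter μ) (𝓝 c) := by
  rw [Metric.nhds_basis_eball.tendsto_right_iff]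
  simp only [eventually_probFilter_iff, Metric.mem_eball, not_lt]
  rfl

lemma eventually_probFilter_of_ae {P : ℕ × Ω → Prop} (h : ∀ n, ∀ᵐ ω ∂μ, P (n, ω)) :
    ∀ᶠ x in probFilter μ, P x := by
  rw [eventually_probFilter_iff]
  have : (fun n => μ {ω | ¬ P (n, ω)}) = fun _ => 0 := funext fun n => ae_iff.1 (h n)
  rw [this]
  exact tendsto_const_nhds

lemma tendsto_fst_probFilter : Tendsto Prod.fst (probFilter μ) atTop := by
  rw [tendsto_atTop]
  intro N
  rw [eventually_probFilter_iff]
  refine tendsto_const_nhds.congr' ?_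
  filter_upwards [eventually_ge_atTop N] with n hn
  simp [hn]

end ProbFilter

/-! ### Averages of square integrable statistics of iid data -/

section Statistics

variable {Ω 𝓩 : Type*} [MeasurableSpace Ω] [MeasurableSpace 𝓩] {μ : Measure Ω} {Z : ℕ → Ω → 𝓩}
  {f f' : ℕ → Ω → ℝ}

/-- `f i` is, almost surely, one and the same measurable function of the observation `Z i` for all
units `i`, and it is square integrable for the representative unit `0`. Almost sure equality admits
statistics that are written in terms of unobserved errors. -/
structure IsL2Statistic (μ : Measure Ω) (Z : ℕ → Ω → 𝓩) (f : ℕ → Ω → ℝ) : Prop where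
  exists_comp : ∃ h : 𝓩 → ℝ, Measurable h ∧ ∀ i, f i =ᵐ[μ] h ∘ Z i
  memLp : MemLp (f 0) 2 μ

namespace IsL2Statistic

lemma congr (hf : IsL2Statistic μ Z f) (h : ∀ i, f' i =ᵐ[μ] f i) : IsL2Statistic μ Z f' := by
  obtain ⟨⟨u, hu, hfu⟩, hL⟩ := hf
  exact ⟨⟨u, hu, fun i => (h i).trans (hfu i)⟩, hL.ae_eq (h 0).symm⟩

lemma const [IsFiniteMeasure μ] (c : ℝ) : IsL2Statistic μ Z (fun _ _ => c) :=
  ⟨⟨fun _ => c, measurable_const, fun _ => Eventually.of_forall fun _ => rfl⟩, memLp_const c⟩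

lemma add (hf : IsL2Statistic μ Z f) (hf' : IsL2Statistic μ Z f') :
    IsL2Statistic μ Z (fun i ω => f i ω + f' i ω) := by
  obtain ⟨⟨u, hu, hfu⟩, hL⟩ := hf
  obtain ⟨⟨u', hu', hfu'⟩, hL'⟩ := hf'
  refine ⟨⟨fun z => u z + u' z, hu.add hu', fun i => ?_⟩, hL.add hL'⟩
  filter_upwards [hfu i, hfu' i] with ω h h'
  simp [h, h']

lemma const_mul (hf : IsL2Statistic μ Z f) (c : ℝ) :
    IsL2Statistic μ Z (fun i ω => c * f i ω) := by
  obtain ⟨⟨u, hu, hfu⟩, hL⟩ := hf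
  refine ⟨⟨fun z => c * u z, hu.const_mul c, fun i => ?_⟩, hL.const_mul c⟩
  filter_upwards [hfu i] with ω h
  simp [h]

lemma sub (hf : IsL2Statistic μ Z f) (hf' : IsL2Statistic μ Z f') :
    IsL2Statistic μ Z (fun i ω => f i ω - f' i ω) := by
  simpa [sub_eq_add_neg] using hf.add (hf'.const_mul (-1))

lemma finset_sum [IsFiniteMeasure μ] {ι : Type*} {F : ι → ℕ → Ω → ℝ} (s : Finset ι)
    (hF : ∀ k ∈ s, IsL2Statistic μ Z (F k)) :
    IsL2Statistic μ Z (fun i ω => ∑ k ∈ s, F k i ω) := by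
  classical
  induction s using Finset.induction_on with
  | empty => simpa using const (μ := μ) (Z := Z) 0
  | insert a s ha ih =>
    simp only [Finset.sum_insert ha]
    exact (hF a (Finset.mem_insert_self a s)).add
      (ih fun k hk => hF k (Finset.mem_insert_of_mem hk))

lemma iIndepFun (hf : IsL2Statistic μ Z f) (hZ : iIndepFun Z μ) :
    ProbabilityTheory.iIndepFun f μ := by
  obtain ⟨u, hu, hfu⟩ := hf.exists_comp
  exact (hZ.comp (fun _ => u) fun _ => hu).congr fun i => (hfu i).symm

lemma identDistrib (hf : IsL2Statistic μ Z f) (hZ : ∀ i, IdentDistrib (Z i) (Z 0) μ μ) (i : ℕ) :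
    IdentDistrib (f i) (f 0) μ μ := by
  obtain ⟨u, hu, hfu⟩ := hf.exists_comp
  have h (i : ℕ) : IdentDistrib (f i) (u ∘ Z i) μ μ :=
    IdentDistrib.of_ae_eq
      ((hu.comp_aemeasurable (hZ i).aemeasurable_fst).congr (hfu i).symm) (hfu i)
  exact (h i).trans (((hZ i).comp hu).trans (h 0).symm)

lemma aemeasurable (hf : IsL2Statistic μ Z f) (hZ : ∀ i, IdentDistrib (Z i) (Z 0) μ μ) (i : ℕ) :
    AEMeasurable (f i) μ :=
  (hf.identDistrib hZ i).aemeasurable_fst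

lemma integrable [IsFiniteMeasure μ] (hf : IsL2Statistic μ Z f) : Integrable (f 0) μ :=
  hf.memLp.integrable one_le_two

end IsL2Statistic

/-- `(√n)⁻¹ ∑_{i < n} f i`. -/
noncomputable def normalizedSum {Ω : Type*} (f : ℕ → Ω → ℝ) (x : ℕ × Ω) : ℝ :=
  (√(x.1 : ℝ))⁻¹ * ∑ i ∈ Finset.range x.1, f i x.2

lemma tendsto_inv_sqrt_probFilter :
    Tendsto (fun x : ℕ × Ω => (√(x.1 : ℝ))⁻¹) (probFilter μ) (𝓝 0) :=
  (tendsto_inv_atTop_zero.comp (Real.tendsto_sqrt_atTop.comp tendsto_natCast_atTop_atTop)).comp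
    tendsto_fst_probFilter

lemma inv_sqrt_mul_normalizedSum {Ω : Type*} (f : ℕ → Ω → ℝ) (x : ℕ × Ω) :
    (√(x.1 : ℝ))⁻¹ * normalizedSum f x = IFEPanel.sampleMean x.1 f x.2 := by
  rw [normalizedSum, IFEPanel.sampleMean, ← mul_assoc, ← mul_inv,
    Real.mul_self_sqrt (Nat.cast_nonneg _)]

variable [IsProbabilityMeasure μ]

/-- The normalized sums of a centred square integrable statistic of iid data are bounded in
probability: by Chebyshev, since their variances do not depend on `n ≥ 1`. -/
lemma measure_le_abs_normalizedSum_le (hf : IsL2Statistic μ Z f) (hZ : iIndepFun Z μ)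
    (hid : ∀ i, IdentDistrib (Z i) (Z 0) μ μ) (h0 : ∫ ω, f 0 ω ∂μ = 0) {K : ℝ} (hK : 0 < K)
    (n : ℕ) :
    μ {ω | K ≤ |normalizedSum f (n, ω)|} ≤ ENNReal.ofReal (Var[f 0; μ] / K ^ 2) := by
  have hL (i : ℕ) : MemLp (f i) 2 μ := (hf.identDistrib hid i).memLp_iff.2 hf.memLp
  have hm (i : ℕ) : ∫ ω, f i ω ∂μ = 0 := by rw [(hf.identDistrib hid i).integral_eq, h0]
  have hsum : MemLp (∑ i ∈ Finset.range n, f i) 2 μ := memLp_finsetSum' _ fun i _ => hL i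
  have heq : (fun ω => normalizedSum f (n, ω)) =
      fun ω => (√(n : ℝ))⁻¹ * (∑ i ∈ Finset.range n, f i) ω := by
    ext ω; simp [normalizedSum]
  have hS : MemLp (fun ω => normalizedSum f (n, ω)) 2 μ := by
    rw [heq]; exact hsum.const_mul _
  have hmean : ∫ ω, normalizedSum f (n, ω) ∂μ = 0 := by
    simp only [normalizedSum]
    rw [integral_const_mul, integral_finsetSum _ fun i _ => (hL i).integrable one_le_two]
    simp [hm]
  have hvar : Var[fun ω => normalizedSum f (n, ω); μ] ≤ Var[f 0; μ] := by
    rw [heq, variance_const_mul, IndepFun.variance_sum (fun i _ => hL i)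
      fun i _ j _ hij => (hf.iIndepFun hZ).indepFun hij]
    simp only [(hf.identDistrib hid _).variance_eq, Finset.sum_const, Finset.card_range,
      nsmul_eq_mul, inv_pow]
    rw [Real.sq_sqrt (Nat.cast_nonneg n), ← mul_assoc]
    exact mul_le_of_le_one_left (variance_nonneg _ _) (inv_mul_le_one)
  have h := meas_ge_le_variance_div_sq hS hK
  simp only [hmean, sub_zero] at h
  refine h.trans (ENNReal.ofReal_le_ofReal ?_)
  gcongr

/-- An `o_p(1)` factor times a normalized sum of centred square integrable statistics is
`o_p(1)`. -/
lemma tendsto_mul_normalizedSum (hf : IsL2Statistic μ Z f) (hZ : iIndepFun Z μ)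
    (hid : ∀ i, IdentDistrib (Z i) (Z 0) μ μ) (h0 : ∫ ω, f 0 ω ∂μ = 0) {X : ℕ × Ω → ℝ}
    (hX : Tendsto X (probFilter μ) (𝓝 0)) :
    Tendsto (fun x => X x * normalizedSum f x) (probFilter μ) (𝓝 0) := by
  rw [Metric.tendsto_nhds] at hX ⊢
  intro ε hε
  rw [eventually_probFilter_iff, ENNReal.tendsto_nhds_zero]
  intro δ hδ
  have hδ2 : 0 < δ / 2 := ENNReal.half_pos hδ.ne'
  -- a bound `K` that the normalized sums exceed with probability at most `δ / 2`
  obtain ⟨K, hKδ, hK⟩ : ∃ K : ℝ, ENNReal.ofReal (Var[f 0; μ] / K ^ 2) ≤ δ / 2 ∧ 0 < K := by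
    have : Tendsto (fun K : ℝ => ENNReal.ofReal (Var[f 0; μ] / K ^ 2)) atTop (𝓝 0) := by
      rw [← ENNReal.ofReal_zero]
      exact (ENNReal.continuous_ofReal.tendsto 0).comp
        (tendsto_const_nhds.div_atTop (tendsto_pow_atTop two_ne_zero))
    exact (((ENNReal.tendsto_nhds_zero.1 this _ hδ2).and (eventually_gt_atTop 0))).exists
  have hX' := hX (ε / K) (by positivity)
  rw [eventually_probFilter_iff, ENNReal.tendsto_nhds_zero] at hX'
  filter_upwards [hX' _ hδ2] with n hn
  calc μ {ω | ¬ dist (X (n, ω) * normalizedSum f (n, ω)) 0 < ε}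
      ≤ μ ({ω | ¬ dist (X (n, ω)) 0 < ε / K} ∪ {ω | K ≤ |normalizedSum f (n, ω)|}) := by
        refine measure_mono fun ω hω => ?_
        by_contra hcon
        simp only [Set.mem_union, Set.mem_ofPred_eq, not_or, not_not, not_le, Real.dist_eq,
          sub_zero, abs_mul] at hcon hω
        refine hω ?_
        calc |X (n, ω)| * |normalizedSum f (n, ω)|
            ≤ |X (n, ω)| * K := by gcongr; exact hcon.2.le
          _ < ε / K * K := by gcongr; exact hcon.1
          _ = ε := by field_simp
    _ ≤ δ / 2 + δ / 2 := (measure_union_le _ _).trans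
        (add_le_add hn ((measure_le_abs_normalizedSum_le hf hZ hid h0 hK n).trans hKδ))
    _ = δ := ENNReal.add_halves δ

/-- Weak law of large numbers. -/
lemma tendsto_sampleMean (hf : IsL2Statistic μ Z f) (hZ : iIndepFun Z μ)
    (hid : ∀ i, IdentDistrib (Z i) (Z 0) μ μ) :
    Tendsto (fun x : ℕ × Ω => IFEPanel.sampleMean x.1 f x.2) (probFilter μ)
      (𝓝 (∫ ω, f 0 ω ∂μ)) := by
  set m := ∫ ω, f 0 ω ∂μ with hm
  have hc : IsL2Statistic μ Z fun i ω => f i ω - m := hf.sub (.const m)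
  have hc0 : ∫ ω, (f 0 ω - m) ∂μ = 0 := by
    rw [integral_sub hf.integrable (integrable_const _)]; simp [hm]
  have h := (tendsto_mul_normalizedSum hc hZ hid hc0 tendsto_inv_sqrt_probFilter).add_const m
  rw [zero_add] at h
  refine h.congr' ?_
  filter_upwards [tendsto_fst_probFilter.eventually (eventually_gt_atTop 0)] with x hx
  rw [inv_sqrt_mul_normalizedSum]
  have : (x.1 : ℝ) ≠ 0 := by positivity
  simp only [IFEPanel.sampleMean, Finset.sum_sub_distrib, Finset.sum_const, Finset.card_range,
    nsmul_eq_mul]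
  field_simp
  ring

/-- Central limit theorem for a centred square integrable statistic of iid data. -/
lemma tendstoInDistribution_normalizedSum (hf : IsL2Statistic μ Z f) (hZ : iIndepFun Z μ)
    (hid : ∀ i, IdentDistrib (Z i) (Z 0) μ μ) (h0 : ∫ ω, f 0 ω ∂μ = 0) :
    TendstoInDistribution (fun (n : ℕ) ω => normalizedSum f (n, ω)) atTop id (fun _ => μ)
      (gaussianReal 0 (∫ ω, f 0 ω ^ 2 ∂μ).toNNReal) := by
  have hv : Var[f 0; μ] = ∫ ω, f 0 ω ^ 2 ∂μ :=
    variance_of_integral_eq_zero hf.memLp.aestronglyMeasurable.aemeasurable h0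
  have h := tendstoInDistribution_inv_sqrt_mul_sum_sub (P := μ) (X := f) (Y := id)
    (P' := gaussianReal 0 (∫ ω, f 0 ω ^ 2 ∂μ).toNNReal) (by rw [hv]; exact HasLaw.id)
    hf.memLp (hf.iIndepFun hZ) (hf.identDistrib hid)
  simpa [h0, normalizedSum] using h

end Statistics

/-! ### Weighted least squares matrices -/

section Matrices

variable {m k : Type*} [Fintype m] [Fintype k] [DecidableEq k]

lemma mulVec_injective_of_rank_eq_card {m k : Type*} [Fintype k] {G : Matrix m k ℝ}
    (h : G.rank = Fintype.card k) :
    Function.Injective G.mulVec := by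
  rw [Matrix.mulVec_injective_iff, linearIndependent_iff_card_eq_finrank_span, ← h,
    Matrix.rank_eq_finrank_span_cols]
  rfl

lemma isUnit_det_of_rank_eq_card {M : Matrix k k ℝ} (h : M.rank = Fintype.card k) :
    IsUnit M.det :=
  (Matrix.isUnit_iff_isUnit_det M).1
    (Matrix.mulVec_injective_iff_isUnit.1 (mulVec_injective_of_rank_eq_card h))

lemma isUnit_det_transpose_mul_mul {G : Matrix m k ℝ} {W : Matrix m m ℝ} (hW : W.PosDef)
    (hG : Function.Injective G.mulVec) : IsUnit (Gᵀ * W * G).det := by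
  have h := hW.conjTranspose_mul_mul_same hG
  rw [Matrix.conjTranspose_eq_transpose_of_trivial] at h
  exact h.det_pos.ne'.isUnit

/-- The matrix `(G' W G)⁻¹ G' W` of least squares with weights `W` is a left inverse of `G`. -/
lemma weightedLeastSquares_mulVec {G : Matrix m k ℝ} {W : Matrix m m ℝ}
    (h : IsUnit (Gᵀ * W * G).det) (d : k → ℝ) (u : m → ℝ) :
    ((Gᵀ * W * G)⁻¹ * Gᵀ * W) *ᵥ (G *ᵥ d + u) = d + ((Gᵀ * W * G)⁻¹ * Gᵀ * W) *ᵥ u := by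
  rw [Matrix.mulVec_add, Matrix.mulVec_mulVec, Matrix.mul_assoc, Matrix.mul_assoc,
    ← Matrix.mul_assoc _ W G, Matrix.nonsing_inv_mul _ h, Matrix.one_mulVec]

lemma tendsto_matrix_of_entries {α a b : Type*} {l : Filter α} {A : α → Matrix a b ℝ}
    {A₀ : Matrix a b ℝ} (h : ∀ i j, Tendsto (fun x => A x i j) l (𝓝 (A₀ i j))) :
    Tendsto A l (𝓝 A₀) :=
  tendsto_pi_nhds.2 fun i => tendsto_pi_nhds.2 fun j => h i j

lemma tendsto_matrix_mul {α a b c : Type*} [Fintype b] {l : Filter α} {A : α → Matrix a b ℝ}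
    {B : α → Matrix b c ℝ} {A₀ : Matrix a b ℝ} {B₀ : Matrix b c ℝ} (hA : Tendsto A l (𝓝 A₀))
    (hB : Tendsto B l (𝓝 B₀)) : Tendsto (fun x => A x * B x) l (𝓝 (A₀ * B₀)) := by
  refine tendsto_matrix_of_entries fun i j => ?_
  simp only [Matrix.mul_apply]
  exact tendsto_finsetSum _ fun r _ =>
    (tendsto_pi_nhds.1 (tendsto_pi_nhds.1 hA i) r).mul
      (tendsto_pi_nhds.1 (tendsto_pi_nhds.1 hB r) j)

lemma tendsto_matrix_transpose {α a b : Type*} {l : Filter α} {A : α → Matrix a b ℝ}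
    {A₀ : Matrix a b ℝ} (hA : Tendsto A l (𝓝 A₀)) : Tendsto (fun x => (A x)ᵀ) l (𝓝 A₀ᵀ) :=
  tendsto_matrix_of_entries fun i j => tendsto_pi_nhds.1 (tendsto_pi_nhds.1 hA j) i

lemma tendsto_transpose_mul_mul {α m k : Type*} [Fintype m] {l : Filter α} {Gh : α → Matrix m k ℝ}
    {Wh : α → Matrix m m ℝ} {G : Matrix m k ℝ} {W : Matrix m m ℝ} (hG : Tendsto Gh l (𝓝 G))
    (hW : Tendsto Wh l (𝓝 W)) :
    Tendsto (fun x => (Gh x)ᵀ * Wh x * Gh x) l (𝓝 (Gᵀ * W * G)) :=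
  tendsto_matrix_mul (tendsto_matrix_mul (tendsto_matrix_transpose hG) hW) hG

lemma tendsto_weightedLeastSquares {α : Type*} {l : Filter α} {Gh : α → Matrix m k ℝ}
    {Wh : α → Matrix m m ℝ} {G : Matrix m k ℝ} {W : Matrix m m ℝ} (hG : Tendsto Gh l (𝓝 G))
    (hW : Tendsto Wh l (𝓝 W)) (h : IsUnit (Gᵀ * W * G).det) :
    Tendsto (fun x => ((Gh x)ᵀ * Wh x * Gh x)⁻¹ * (Gh x)ᵀ * Wh x) l
      (𝓝 ((Gᵀ * W * G)⁻¹ * Gᵀ * W)) := by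
  have hM := tendsto_transpose_mul_mul hG hW
  have hinv : Tendsto (fun x => ((Gh x)ᵀ * Wh x * Gh x)⁻¹) l (𝓝 (Gᵀ * W * G)⁻¹) := by
    simp only [Matrix.inv_def, Ring.inverse_eq_inv']
    have hdet : Continuous fun M : Matrix k k ℝ => M.det := by fun_prop
    have hadj : Continuous fun M : Matrix k k ℝ => M.adjugate := by fun_prop
    exact (((hdet.tendsto _).comp hM).inv₀ h.ne_zero).smul ((hadj.tendsto _).comp hM)
  exact tendsto_matrix_mul (tendsto_matrix_mul hinv (tendsto_matrix_transpose hG)) hW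

variable {Ω : Type*} [MeasurableSpace Ω] {μ : Measure Ω}

lemma aemeasurable_matrix_mul {a b c : Type*} [Fintype b] {M : Ω → Matrix a b ℝ}
    {N : Ω → Matrix b c ℝ} (hM : ∀ i j, AEMeasurable (fun ω => M ω i j) μ)
    (hN : ∀ i j, AEMeasurable (fun ω => N ω i j) μ) (i : a) (j : c) :
    AEMeasurable (fun ω => (M ω * N ω) i j) μ := by
  simp only [Matrix.mul_apply]
  exact Finset.aemeasurable_fun_sum _ fun l _ => (hM i l).mul (hN l j)

lemma aemeasurable_matrix_inv {M : Ω → Matrix k k ℝ}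
    (hM : ∀ i j, AEMeasurable (fun ω => M ω i j) μ) (i j : k) :
    AEMeasurable (fun ω => (M ω)⁻¹ i j) μ := by
  simp only [Matrix.inv_def, Ring.inverse_eq_inv', Matrix.smul_apply, smul_eq_mul]
  have hpi : AEMeasurable (fun ω (i j : k) => M ω i j) μ :=
    aemeasurable_pi_lambda _ fun i => aemeasurable_pi_lambda _ fun j => hM i j
  have hdet : Continuous fun A : k → k → ℝ => (Matrix.of A).det :=
    Continuous.matrix_det (A := fun A : k → k → ℝ => Matrix.of A) continuous_id
  have hadj : Continuous fun A : k → k → ℝ => (Matrix.of A).adjugate i j :=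
    (Continuous.matrix_adjugate (A := fun A : k → k → ℝ => Matrix.of A)
      continuous_id).matrix_elem i j
  exact (hdet.measurable.comp_aemeasurable hpi).inv.mul (hadj.measurable.comp_aemeasurable hpi)

end Matrices

namespace IFEPanel

variable {Ω : Type*} [MeasurableSpace Ω] {R T : ℕ} {S : IFEPanel Ω R T} {μ : Measure Ω}

/-! ### Groups -/

/-- The group is a function of the finitely many treatment indicators. -/
lemma measurable_G (S : IFEPanel Ω R T) (i : ℕ) : Measurable (S.G i) := by
  let Φ : (Finset.Icc 1 T → Bool) → ℕ∞ := fun d =>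
    sInf {x : ℕ∞ | ∃ t : Finset.Icc 1 T, d t = true ∧ x = ((t : ℕ) : ℕ∞)}
  have hΦ : S.G i = Φ ∘ fun ω (t : Finset.Icc 1 T) => S.D i t ω := by
    ext1 ω
    simp only [G, Φ, Function.comp, Subtype.exists]
    congr 1
    ext x
    simp only [Set.mem_ofPred_eq, exists_prop]
  rw [hΦ]
  exact (measurable_of_finite Φ).comp (measurable_pi_lambda _ fun t => S.measurable_D i t)

lemma measurableSet_G_eq (S : IFEPanel Ω R T) (g : ℕ∞) (i : ℕ) :
    MeasurableSet {ω | S.G i ω = g} :=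
  S.measurable_G i (measurableSet_singleton g)

lemma measurable_ind (S : IFEPanel Ω R T) (g : ℕ∞) (i : ℕ) : Measurable (S.ind g i) :=
  Measurable.ite (S.measurableSet_G_eq g i) measurable_const measurable_const

lemma abs_ind_le_one (S : IFEPanel Ω R T) (g : ℕ∞) (i : ℕ) (ω : Ω) : |S.ind g i ω| ≤ 1 := by
  unfold ind; split_ifs <;> simp

lemma integral_ind_mul (S : IFEPanel Ω R T) (g : ℕ∞) (f : Ω → ℝ) :
    ∫ ω, S.ind g 0 ω * f ω ∂μ = ∫ ω in {ω | S.G 0 ω = g}, f ω ∂μ := by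
  rw [← integral_indicator (S.measurableSet_G_eq g 0)]
  refine integral_congr_ae (Eventually.of_forall fun ω => ?_)
  by_cases h : S.G 0 ω = g <;> simp [ind, h]

lemma integral_ind (S : IFEPanel Ω R T) (g : ℕ∞) : ∫ ω, S.ind g 0 ω ∂μ = S.p μ g := by
  have h := S.integral_ind_mul (μ := μ) g fun _ => 1
  simpa [p] using h

lemma integrable_ind_mul (S : IFEPanel Ω R T) (g : ℕ∞) (i : ℕ) {f : Ω → ℝ}
    (hf : Integrable f μ) : Integrable (fun ω => S.ind g i ω * f ω) μ :=
  hf.bdd_mul (S.measurable_ind g i).aestronglyMeasurable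
    (Eventually.of_forall fun ω => S.abs_ind_le_one g i ω)

lemma p_pos_of_mem_groups {g : ℕ∞} (hg : g ∈ S.groups μ) : 0 < S.p μ g :=
  (Finset.mem_filter.1 hg).2

lemma lt_of_mem_comp {t : ℕ} (g : S.comp μ t) : (t : ℕ∞) < g :=
  (Finset.mem_filter.1 g.2).2

lemma tMax_le : S.tMax μ ≤ T :=
  Finset.sup_le fun _ ht => (Finset.mem_Icc.1 (Finset.mem_filter.1 ht).1).2

/-! ### Errors have mean zero within each group -/

/-- `f` is integrable, and has mean zero on the event `{G = g}` for every group `g`. -/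
structure IsGroupMeanZero (S : IFEPanel Ω R T) (μ : Measure Ω) (f : Ω → ℝ) : Prop where
  integrable : Integrable f μ
  integral_ind_mul_eq_zero : ∀ g, ∫ ω, S.ind g 0 ω * f ω ∂μ = 0

namespace IsGroupMeanZero

variable {f f' : Ω → ℝ}

lemma sub (hf : S.IsGroupMeanZero μ f) (hf' : S.IsGroupMeanZero μ f') :
    S.IsGroupMeanZero μ fun ω => f ω - f' ω := by
  refine ⟨hf.integrable.sub hf'.integrable, fun g => ?_⟩
  simp only [mul_sub]
  rw [integral_sub (S.integrable_ind_mul g 0 hf.integrable)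
    (S.integrable_ind_mul g 0 hf'.integrable), hf.2, hf'.2, sub_zero]

lemma sum_const_mul {ι : Type*} (s : Finset ι) (c : ι → ℝ) {F : ι → Ω → ℝ}
    (hF : ∀ k ∈ s, S.IsGroupMeanZero μ (F k)) :
    S.IsGroupMeanZero μ fun ω => ∑ k ∈ s, c k * F k ω := by
  refine ⟨integrable_finsetSum _ fun k hk => (hF k hk).integrable.const_mul (c k), fun g => ?_⟩
  simp only [Finset.mul_sum, mul_left_comm _ (c _)]
  rw [integral_finsetSum _ fun k hk =>
    (S.integrable_ind_mul g 0 (hF k hk).integrable).const_mul (c k)]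
  exact Finset.sum_eq_zero fun k hk => by rw [integral_const_mul, (hF k hk).2, mul_zero]

end IsGroupMeanZero

/-- Subtracting the `(η, λ)`-measurable part of `Y_s(0)` from both sides of unconfoundedness gives
`E[e_s | η, λ, G] = E[e_s | η, λ] = 0`, hence `E[1{G = g} e_s] = 0`. -/
lemma isGroupMeanZero_e [IsProbabilityMeasure μ] (hIFE : S.IFEModel μ)
    (hUnconf : S.Unconfoundedness μ) {s : ℕ} (hs : s ∈ Finset.Icc 1 T) :
    S.IsGroupMeanZero μ (S.e 0 s) := by
  obtain ⟨he_int, he⟩ := hIFE.2 s hs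
  obtain ⟨hY_int, hY⟩ := hUnconf s hs
  refine ⟨he_int, fun g => ?_⟩
  -- `condExp` has its intended meaning only for sub-σ-algebras of the ambient one
  have hle : S.sigmaHetG ≤ (inferInstance : MeasurableSpace Ω) :=
    ((S.measurable_η 0).prodMk ((S.measurable_lam 0).prodMk (S.measurable_G 0))).comap_le
  have hle' : S.sigmaHet ≤ (inferInstance : MeasurableSpace Ω) :=
    ((S.measurable_η 0).prodMk (S.measurable_lam 0)).comap_le
  have hηG : Measurable[S.sigmaHetG] fun ω => (S.η 0 ω, S.lam 0 ω, S.G 0 ω) :=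
    comap_measurable _
  have hη : Measurable[S.sigmaHet] fun ω => (S.η 0 ω, S.lam 0 ω) := comap_measurable _
  -- `q` is the `(η, λ)`-measurable part of `Y_s(0)`; only this sum need be integrable, not `η`
  let c : ℝ × (Fin R → ℝ) → ℝ := fun x => S.θ s + x.1 + x.2 ⬝ᵥ S.F s
  have hc : Measurable c := by
    have : Continuous c := by fun_prop
    exact this.measurable
  let q : Ω → ℝ := fun ω => c (S.η 0 ω, S.lam 0 ω)
  have heq : S.e 0 s =ᵐ[μ] S.Y0 0 s - q := by
    filter_upwards [hIFE.1 0] with ω hω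
    simp only [Pi.sub_apply, q, c, hω s hs]
    ring
  have hq_int : Integrable q μ := by
    refine (hY_int.sub he_int).congr ?_
    filter_upwards [heq] with ω hω
    simp [hω]
  have hqG : μ[q | S.sigmaHetG] = q := by
    refine condExp_of_stronglyMeasurable hle ?_ hq_int
    have : Measurable[S.sigmaHetG] q :=
      (hc.comp (measurable_fst.prodMk (measurable_fst.comp measurable_snd))).comp hηG
    exact this.stronglyMeasurable
  have hq : μ[q | S.sigmaHet] = q := by
    refine condExp_of_stronglyMeasurable hle' ?_ hq_int
    have : Measurable[S.sigmaHet] q := hc.comp hη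
    exact this.stronglyMeasurable
  have hzero : μ[S.e 0 s | S.sigmaHetG] =ᵐ[μ] 0 := by
    have h1 := (condExp_congr_ae (m := S.sigmaHetG) heq).trans
      (condExp_sub hY_int hq_int S.sigmaHetG)
    have h2 := (condExp_congr_ae (m := S.sigmaHet) heq).trans
      (condExp_sub hY_int hq_int S.sigmaHet)
    filter_upwards [h1, h2, hY, he] with ω h1 h2 h3 h4
    rw [h1, Pi.sub_apply, h3, hqG, ← h4, h2, Pi.sub_apply, hq]
  have hGm : MeasurableSet[S.sigmaHetG] {ω | S.G 0 ω = g} :=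
    (measurable_snd.comp (measurable_snd.comp hηG)) (measurableSet_singleton g)
  rw [integral_ind_mul, ← setIntegral_condExp hle he_int hGm,
    integral_congr_ae (ae_restrict_of_ae hzero)]
  simp

/-! ### The estimating equation -/

variable {g t : ℕ} {Om : Matrix (Fin (g - 2)) (Fin R) ℝ}

lemma isUnit_det_transpose_mul_ΔFpre (hF : S.RankFactors g) (hOm : S.AdmissibleOm Om) :
    IsUnit (Omᵀ * S.ΔFpre g).det :=
  isUnit_det_of_rank_eq_card (by rw [hOm.2, hF, Fintype.card_fin])

lemma mem_Icc_of_fin (hgT : g ≤ T) (k : Fin (g - 2)) :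
    (k : ℕ) + 1 ∈ Finset.Icc 1 T ∧ (k : ℕ) + 2 ∈ Finset.Icc 1 T := by
  have := k.2
  simp only [Finset.mem_Icc]
  omega

lemma ae_Y_eq (hNoAnt : S.NoAnticipation μ) (hIFE : S.IFEModel μ) (i : ℕ) :
    ∀ᵐ ω ∂μ, ∀ s ∈ Finset.Icc 1 T, (s : ℕ∞) < S.G i ω →
      S.Y i s ω = S.θ s + S.η i ω + S.lam i ω ⬝ᵥ S.F s + S.e i s ω := by
  filter_upwards [hNoAnt i, hIFE.1 i] with ω h1 h2 s hs hsG
  rw [h1 s hs hsG, h2 s hs]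

lemma dotProduct_cons (x : Fin (R + 1) → ℝ) (a : ℝ) (w : Fin R → ℝ) :
    x ⬝ᵥ (Fin.cons a w : Fin (R + 1) → ℝ) = x 0 * a + (fun r => x r.succ) ⬝ᵥ w := by
  simp [dotProduct, Fin.sum_univ_succ]

/-- The pre-treatment regressors of a unit not treated before period `g`. -/
lemma ae_transpose_mulVec_ΔY (hNoAnt : S.NoAnticipation μ) (hIFE : S.IFEModel μ) (hgT : g ≤ T)
    (i : ℕ) : ∀ᵐ ω ∂μ, (g : ℕ∞) ≤ S.G i ω →
      (Omᵀ *ᵥ fun k : Fin (g - 2) => S.Y i (k + 2) ω - S.Y i (k + 1) ω) =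
        Omᵀ *ᵥ (fun k => S.θ (k + 2) - S.θ (k + 1)) + (Omᵀ * S.ΔFpre g) *ᵥ S.lam i ω +
          Omᵀ *ᵥ (fun k => S.e i (k + 2) ω - S.e i (k + 1) ω) := by
  filter_upwards [ae_Y_eq hNoAnt hIFE i] with ω hω hG
  rw [← Matrix.mulVec_mulVec, ← Matrix.mulVec_add, ← Matrix.mulVec_add]
  congr 1
  ext k
  have hk := k.2
  have hlt {s : ℕ} (hs : s < g) : (s : ℕ∞) < S.G i ω := lt_of_lt_of_le (by exact_mod_cast hs) hG
  have h1 := hω (k + 1) (mem_Icc_of_fin hgT k).1 (hlt (by omega))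
  have h2 := hω (k + 2) (mem_Icc_of_fin hgT k).2 (hlt (by omega))
  have h3 : (S.ΔFpre g *ᵥ S.lam i ω) k
      = S.lam i ω ⬝ᵥ S.F (k + 2) - S.lam i ω ⬝ᵥ S.F (k + 1) := by
    simp [Matrix.mulVec, dotProduct, ΔFpre, sub_mul, ← Finset.sum_sub_distrib,
      mul_comm (S.lam i ω _)]
  simp only [Pi.add_apply, h1, h2, h3]
  ring

/-- The quasi-differenced outcome equation: the loadings are eliminated by solving the
pre-treatment differences for them. -/
lemma ae_Y0_sub_Y (hNoAnt : S.NoAnticipation μ) (hIFE : S.IFEModel μ) (hF : S.RankFactors g)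
    (hOm : S.AdmissibleOm Om) (hg2 : 2 ≤ g) (hgT : g ≤ T) (ht : t ∈ Finset.Icc 1 T) (i : ℕ) :
    ∀ᵐ ω ∂μ, (g : ℕ∞) ≤ S.G i ω →
      S.Y0 i t ω - S.Y i (g - 1) ω =
        S.deltaStar Om t ⬝ᵥ S.regressor Om i ω + S.v Om t i ω := by
  filter_upwards [ae_Y_eq hNoAnt hIFE i, ae_transpose_mulVec_ΔY (Om := Om) hNoAnt hIFE hgT i,
    hIFE.1 i] with ω hY hX hY0 hG
  have hM := isUnit_det_transpose_mul_ΔFpre hF hOm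
  have hlt : ((g - 1 : ℕ) : ℕ∞) < S.G i ω :=
    lt_of_lt_of_le (by exact_mod_cast (by omega : g - 1 < g)) hG
  rw [hY0 t ht, hY (g - 1) (Finset.mem_Icc.2 (by omega)) hlt, deltaStar, regressor,
    dotProduct_cons, hX hG]
  simp only [Fin.cons_zero, Fin.cons_succ, mul_one, FStar, v, thetaStar, Hpre,
    ← Matrix.dotProduct_mulVec, Matrix.mulVec_mulVec,
    Matrix.nonsing_inv_mul _ hM, Matrix.one_mulVec, dotProduct_add]
  rw [sub_dotProduct _ _ (S.lam i ω), dotProduct_comm _ (S.lam i ω),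
    dotProduct_comm _ (S.lam i ω)]
  ring

lemma isGroupMeanZero_v [IsProbabilityMeasure μ] (hIFE : S.IFEModel μ)
    (hUnconf : S.Unconfoundedness μ) (hg2 : 2 ≤ g) (hgT : g ≤ T) (ht : t ∈ Finset.Icc 1 T) :
    S.IsGroupMeanZero μ (S.v Om t 0) := by
  have he {s : ℕ} (hs : s ∈ Finset.Icc 1 T) := isGroupMeanZero_e hIFE hUnconf hs
  have h := ((he ht).sub (he (s := g - 1) (Finset.mem_Icc.2 (by omega)))).sub
    (IsGroupMeanZero.sum_const_mul Finset.univ ((S.F t - S.F (g - 1)) ᵥ* S.Hpre Om)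
      fun k _ => (he (mem_Icc_of_fin hgT k).2).sub (he (mem_Icc_of_fin hgT k).1))
  refine (congrArg (S.IsGroupMeanZero μ) ?_).mp h
  ext ω
  rw [v, Matrix.dotProduct_mulVec]
  rfl

/-! ### Statistics of the observed data -/

lemma aemeasurable_obs (hIID : S.IIDSampling μ) (i : ℕ) : AEMeasurable (S.obs i) μ :=
  (hIID.2 i).aemeasurable_fst

lemma isL2Statistic_ind [IsProbabilityMeasure μ] (S : IFEPanel Ω R T) (g : ℕ∞) :
    IsL2Statistic μ S.obs (S.ind g) := by
  refine ⟨⟨fun z => if z.2 = g then 1 else 0,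
    Measurable.ite (measurable_snd (measurableSet_singleton g)) measurable_const measurable_const,
    fun i => Eventually.of_forall fun ω => rfl⟩, ?_⟩
  exact MemLp.of_bound (S.measurable_ind g 0).aestronglyMeasurable 1
    (Eventually.of_forall fun ω => S.abs_ind_le_one g 0 ω)

lemma isL2Statistic_ind_mul (g : ℕ∞) {f : ℕ → Ω → ℝ} (hf : IsL2Statistic μ S.obs f) :
    IsL2Statistic μ S.obs fun i ω => S.ind g i ω * f i ω := by
  obtain ⟨⟨u, hu, hfu⟩, hL⟩ := hf
  refine ⟨⟨fun z => (if z.2 = g then 1 else 0) * u z,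
    (Measurable.ite (measurable_snd (measurableSet_singleton g)) measurable_const
      measurable_const).mul hu, fun i => ?_⟩, ?_⟩
  · filter_upwards [hfu i] with ω hω
    rw [hω]
    rfl
  · refine hL.mono ((S.measurable_ind g 0).aestronglyMeasurable.mul hL.1)
      (Eventually.of_forall fun ω => ?_)
    rw [norm_mul]
    exact mul_le_of_le_one_left (norm_nonneg _) (S.abs_ind_le_one g 0 ω)

lemma isL2Statistic_Y [IsProbabilityMeasure μ] (hIID : S.IIDSampling μ)
    (hMoment : S.FiniteFourthMoment μ) {s : ℕ}
    (hs : s ∈ Finset.Icc 1 T) : IsL2Statistic μ S.obs fun i => S.Y i s := by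
  rw [Finset.mem_Icc] at hs
  let k : Fin T := ⟨s - 1, by omega⟩
  have hk : (k : ℕ) + 1 = s := by simp only [k]; omega
  have hu : Measurable fun z : EuclideanSpace ℝ (Fin T) × ℕ∞ => z.1 k := by fun_prop
  have heq (i : ℕ) : S.Y i s = (fun z : EuclideanSpace ℝ (Fin T) × ℕ∞ => z.1 k) ∘ S.obs i := by
    ext ω
    simp [obs, Yvec, hk]
  refine ⟨⟨_, hu, fun i => Eventually.of_forall fun ω => congrFun (heq i) ω⟩, ?_⟩
  have hm : AEStronglyMeasurable (S.Y 0 s) μ := by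
    rw [heq 0]
    exact (hu.comp_aemeasurable (aemeasurable_obs hIID 0)).aestronglyMeasurable
  rw [memLp_two_iff_integrable_sq hm]
  -- `Y_s² ≤ ‖Y‖² ≤ 1 + ‖Y‖⁴`
  refine ((integrable_const (1 : ℝ)).add hMoment).mono' (hm.pow 2)
    (Eventually.of_forall fun ω => ?_)
  have hle : |S.Y 0 s ω| ≤ ‖S.Yvec 0 ω‖ := by
    have := PiLp.norm_apply_le (S.Yvec 0 ω) k
    simpa [Yvec, hk] using this
  have hsq : S.Y 0 s ω ^ 2 ≤ ‖S.Yvec 0 ω‖ ^ 2 := sq_le_sq.2 (by simpa using hle)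
  rw [Real.norm_eq_abs, abs_of_nonneg (sq_nonneg _), Pi.add_apply]
  nlinarith [sq_nonneg (‖S.Yvec 0 ω‖ ^ 2 - 1)]

lemma isL2Statistic_regressor [IsProbabilityMeasure μ] (hIID : S.IIDSampling μ)
    (hMoment : S.FiniteFourthMoment μ)
    (hgT : g ≤ T) (Om : Matrix (Fin (g - 2)) (Fin R) ℝ) (j : Fin (R + 1)) :
    IsL2Statistic μ S.obs fun i ω => S.regressor Om i ω j := by
  refine Fin.cases ?_ (fun r => ?_) j
  · simpa [regressor] using IsL2Statistic.const (μ := μ) (Z := S.obs) 1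
  · simp only [regressor, Fin.cons_succ, Matrix.mulVec, dotProduct]
    exact IsL2Statistic.finset_sum _ fun k _ =>
      ((isL2Statistic_Y hIID hMoment (mem_Icc_of_fin hgT k).2).sub
        (isL2Statistic_Y hIID hMoment (mem_Icc_of_fin hgT k).1)).const_mul _

lemma isL2Statistic_A [IsProbabilityMeasure μ] (hIID : S.IIDSampling μ)
    (hMoment : S.FiniteFourthMoment μ)
    (hgT : g ≤ T) (Om : Matrix (Fin (g - 2)) (Fin R) ℝ) (j : Fin (R + 1)) :
    IsL2Statistic μ S.obs fun i ω => S.A Om i ω j :=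
  isL2Statistic_ind_mul _ (isL2Statistic_regressor hIID hMoment hgT Om j)

lemma isL2Statistic_ell_mul (g' : S.comp μ t) {f : ℕ → Ω → ℝ} (hf : IsL2Statistic μ S.obs f) :
    IsL2Statistic μ S.obs fun i ω => S.ell μ t i ω g' * f i ω := by
  refine ((isL2Statistic_ind_mul (S := S) g' hf).const_mul (S.p μ g')⁻¹).congr fun i =>
    Eventually.of_forall fun ω => ?_
  simp only [ell]
  ring

lemma isL2Statistic_Y_sub [IsProbabilityMeasure μ] (hIID : S.IIDSampling μ)
    (hMoment : S.FiniteFourthMoment μ)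
    (hg2 : 2 ≤ g) (hgT : g ≤ T) (ht : t ∈ Finset.Icc 1 T) :
    IsL2Statistic μ S.obs fun i ω => S.Y i t ω - S.Y i (g - 1) ω :=
  (isL2Statistic_Y hIID hMoment ht).sub
    (isL2Statistic_Y hIID hMoment (Finset.mem_Icc.2 (by omega)))

/-! ### The moment condition of the comparison groups -/

/-- Comparison groups are untreated at `t`, so that their observed outcomes obey the
quasi-differenced outcome equation. -/
lemma ae_ell_mul_Y_sub (hNoAnt : S.NoAnticipation μ) (hIFE : S.IFEModel μ) (hF : S.RankFactors g)
    (hOm : S.AdmissibleOm Om) (hg2 : 2 ≤ g) (hgT : g ≤ T) (ht : t ∈ Finset.Icc 1 T)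
    (hgt : g ≤ t) (i : ℕ) : ∀ᵐ ω ∂μ, ∀ g' : S.comp μ t,
      S.ell μ t i ω g' * (S.Y i t ω - S.Y i (g - 1) ω) =
        S.ell μ t i ω g' * (S.deltaStar Om t ⬝ᵥ S.regressor Om i ω) +
          S.ell μ t i ω g' * S.v Om t i ω := by
  filter_upwards [ae_Y0_sub_Y hNoAnt hIFE hF hOm hg2 hgT ht i, hNoAnt i] with ω h1 h2 g'
  rw [← mul_add]
  by_cases hG : S.G i ω = g'
  · have hlt : (t : ℕ∞) < S.G i ω := hG ▸ lt_of_mem_comp g'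
    rw [h2 t ht hlt, h1 ((by exact_mod_cast hgt : (g : ℕ∞) ≤ t).trans hlt.le)]
  · simp [ell, ind, hG]

lemma isL2Statistic_ell_mul_v [IsProbabilityMeasure μ] (hIID : S.IIDSampling μ)
    (hNoAnt : S.NoAnticipation μ)
    (hIFE : S.IFEModel μ) (hMoment : S.FiniteFourthMoment μ) (hF : S.RankFactors g)
    (hOm : S.AdmissibleOm Om) (hg2 : 2 ≤ g) (hgT : g ≤ T) (ht : t ∈ Finset.Icc 1 T)
    (hgt : g ≤ t) (g' : S.comp μ t) :
    IsL2Statistic μ S.obs fun i ω => S.ell μ t i ω g' * S.v Om t i ω := by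
  have hX : IsL2Statistic μ S.obs fun i ω => S.deltaStar Om t ⬝ᵥ S.regressor Om i ω :=
    IsL2Statistic.finset_sum _ fun j _ =>
      (isL2Statistic_regressor hIID hMoment hgT Om j).const_mul _
  refine ((isL2Statistic_ell_mul g' (isL2Statistic_Y_sub hIID hMoment hg2 hgT ht)).sub
    (isL2Statistic_ell_mul g' hX)).congr fun i => ?_
  filter_upwards [ae_ell_mul_Y_sub hNoAnt hIFE hF hOm hg2 hgT ht hgt i] with ω hω
  rw [hω g']
  ring

lemma integral_ell_mul_eq_zero {f : Ω → ℝ} (hf : S.IsGroupMeanZero μ f) (g' : S.comp μ t) :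
    ∫ ω, S.ell μ t 0 ω g' * f ω ∂μ = 0 := by
  simp only [ell, div_mul_eq_mul_div]
  rw [integral_div, hf.2, zero_div]

lemma integrable_ell_mul {f : Ω → ℝ} (hf : Integrable f μ) (g' : S.comp μ t) :
    Integrable (fun ω => S.ell μ t 0 ω g' * f ω) μ := by
  simp only [ell, div_mul_eq_mul_div]
  exact (S.integrable_ind_mul _ 0 hf).div_const _

/-- Within the comparison groups the regressors have the mean of a nonsingular affine
transformation of the loadings, so that `Γ` inherits full column rank from `Λ^comp`. -/
lemma Gam_mulVec_injective [IsProbabilityMeasure μ] (hIID : S.IIDSampling μ)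
    (hNoAnt : S.NoAnticipation μ) (hIFE : S.IFEModel μ)
    (hUnconf : S.Unconfoundedness μ) (hMoment : S.FiniteFourthMoment μ)
    (hF : S.RankFactors g) (hLam : S.RankLoadings μ t) (hOm : S.AdmissibleOm Om) (hgT : g ≤ T)
    (hgt : g ≤ t) : Function.Injective (S.Gam μ Om t).mulVec := by
  have hM := isUnit_det_transpose_mul_ΔFpre hF hOm
  have hLinj : Function.Injective (S.LambdaComp μ t).mulVec :=
    mulVec_injective_of_rank_eq_card (by rw [hLam.2, Fintype.card_fin])
  have hlam (j : Fin (R + 1)) :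
      Integrable (fun ω => (Fin.cons 1 (S.lam 0 ω) : Fin (R + 1) → ℝ) j) μ := by
    refine Fin.cases ?_ (fun r => ?_) j
    · simp
    · simpa using hLam.1 r
  -- the linear map `x ↦ y x` is the transpose of the affine transformation of the loadings
  let xs : (Fin (R + 1) → ℝ) → Fin R → ℝ := fun x r => x r.succ
  let y : (Fin (R + 1) → ℝ) → Fin (R + 1) → ℝ := fun x =>
    Fin.cons (x 0 + xs x ⬝ᵥ (Omᵀ *ᵥ fun k => S.θ (k + 2) - S.θ (k + 1)))
      (xs x ᵥ* (Omᵀ * S.ΔFpre g))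
  have key (x : Fin (R + 1) → ℝ) : S.Gam μ Om t *ᵥ x = S.LambdaComp μ t *ᵥ y x := by
    ext g'
    have he : S.IsGroupMeanZero μ fun ω =>
        ∑ k, (xs x ᵥ* Omᵀ) k * (S.e 0 (k + 2) ω - S.e 0 (k + 1) ω) :=
      IsGroupMeanZero.sum_const_mul _ _ fun k _ =>
        (isGroupMeanZero_e hIFE hUnconf (mem_Icc_of_fin hgT k).2).sub
          (isGroupMeanZero_e hIFE hUnconf (mem_Icc_of_fin hgT k).1)
    have hlin (c : Fin (R + 1) → ℝ) (F : Ω → Fin (R + 1) → ℝ)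
        (hFi : ∀ j, Integrable (fun ω => F ω j) μ) :
        ∑ j, (∫ ω, S.ell μ t 0 ω g' * F ω j ∂μ) * c j =
          ∫ ω, S.ell μ t 0 ω g' * (c ⬝ᵥ F ω) ∂μ := by
      simp only [dotProduct, Finset.mul_sum, mul_left_comm _ (c _)]
      rw [integral_finsetSum _ fun j _ => (integrable_ell_mul (hFi j) g').const_mul _]
      exact Finset.sum_congr rfl fun j _ => by rw [integral_const_mul, mul_comm]
    have hlamy : Integrable (fun ω => y x ⬝ᵥ (Fin.cons 1 (S.lam 0 ω) : Fin (R + 1) → ℝ)) μ :=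
      integrable_finsetSum _ fun j _ => (hlam j).const_mul _
    calc (S.Gam μ Om t *ᵥ x) g'
        = ∫ ω, S.ell μ t 0 ω g' * (x ⬝ᵥ S.regressor Om 0 ω) ∂μ :=
          hlin x _ fun j => (isL2Statistic_regressor hIID hMoment hgT Om j).integrable
      _ = ∫ ω, (S.ell μ t 0 ω g' * (y x ⬝ᵥ (Fin.cons 1 (S.lam 0 ω) : Fin (R + 1) → ℝ)) +
            S.ell μ t 0 ω g' *
              ∑ k, (xs x ᵥ* Omᵀ) k * (S.e 0 (k + 2) ω - S.e 0 (k + 1) ω)) ∂μ := by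
          refine integral_congr_ae ?_
          filter_upwards [ae_transpose_mulVec_ΔY (Om := Om) hNoAnt hIFE hgT 0] with ω hω
          rw [← mul_add]
          by_cases hG : S.G 0 ω = g'
          · have hle : (g : ℕ∞) ≤ S.G 0 ω :=
              (by exact_mod_cast hgt : (g : ℕ∞) ≤ t).trans (hG ▸ lt_of_mem_comp g').le
            rw [regressor, dotProduct_cons, dotProduct_cons, hω hle]
            congr 1
            simp only [y, Fin.cons_zero, Fin.cons_succ, dotProduct_add, Matrix.dotProduct_mulVec]
            simp only [xs, dotProduct]
            ring
          · simp [ell, ind, hG]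
      _ = (S.LambdaComp μ t *ᵥ y x) g' := by
          rw [integral_add (integrable_ell_mul hlamy g') (integrable_ell_mul he.integrable g'),
            integral_ell_mul_eq_zero he, add_zero]
          exact (hlin (y x) _ hlam).symm
  refine (injective_iff_map_eq_zero (S.Gam μ Om t).mulVecLin).2 fun x hx => ?_
  have hy : y x = 0 := by
    apply hLinj
    rw [← key, Matrix.mulVec_zero]
    exact hx
  have hxs : xs x = 0 := by
    have h1 : xs x ᵥ* (Omᵀ * S.ΔFpre g) = 0 := by
      ext r
      have := congrFun hy r.succ
      simpa [y] using this
    have h2 := congrArg (fun w => w ᵥ* (Omᵀ * S.ΔFpre g)⁻¹) h1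
    simpa only [Matrix.vecMul_vecMul, Matrix.mul_nonsing_inv _ hM, Matrix.vecMul_one,
      Matrix.zero_vecMul] using h2
  have hx0 : x 0 = 0 := by
    have := congrFun hy 0
    simpa [y, hxs] using this
  ext j
  refine Fin.cases hx0 (fun r => congrFun hxs r) j

/-! ### Identification -/

/-- The average treatment effect on the treated is identified by the quasi-differenced outcome
equation, whose untreated outcome is unobserved in group `g` but whose error has mean zero
there. -/
lemma p_mul_ATT [IsProbabilityMeasure μ] (hIID : S.IIDSampling μ)
    (hNoAnt : S.NoAnticipation μ)
    (hIFE : S.IFEModel μ) (hUnconf : S.Unconfoundedness μ) (hMoment : S.FiniteFourthMoment μ)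
    (hF : S.RankFactors g) (hOm : S.AdmissibleOm Om) (hg2 : 2 ≤ g) (hgT : g ≤ T)
    (ht : t ∈ Finset.Icc 1 T) (hp : 0 < S.p μ g) :
    S.p μ g * S.ATT μ g t =
      ∫ ω, S.ind g 0 ω * (S.Y 0 t ω - S.Y 0 (g - 1) ω) ∂μ -
        S.deltaStar Om t ⬝ᵥ S.EA μ Om := by
  have hv := isGroupMeanZero_v (Om := Om) hIFE hUnconf hg2 hgT ht
  have hA (j) := (isL2Statistic_A hIID hMoment hgT Om j).integrable
  have hN := (isL2Statistic_ind_mul (S := S) g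
    (isL2Statistic_Y_sub hIID hMoment hg2 hgT ht)).integrable
  have hdA : Integrable (fun ω => S.deltaStar Om t ⬝ᵥ S.A Om 0 ω) μ :=
    integrable_finsetSum _ fun j _ => (hA j).const_mul _
  -- the conditional measure is the restriction to `{G = g}` divided by `p_g`
  have h1 : S.p μ g * S.ATT μ g t =
      ∫ ω, S.ind g 0 ω * (S.Ypot 0 g t ω - S.Y0 0 t ω) ∂μ := by
    rw [integral_ind_mul, ATT, ProbabilityTheory.cond, integral_smul_measure, ENNReal.toReal_inv,
      smul_eq_mul, ← mul_assoc]
    exact (congrArg (· * _) (mul_inv_cancel₀ hp.ne')).trans (one_mul _)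
  have h2 : ∫ ω, S.ind g 0 ω * (S.Ypot 0 g t ω - S.Y0 0 t ω) ∂μ =
      ∫ ω, (S.ind g 0 ω * (S.Y 0 t ω - S.Y 0 (g - 1) ω) - S.deltaStar Om t ⬝ᵥ S.A Om 0 ω -
        S.ind g 0 ω * S.v Om t 0 ω) ∂μ := by
    refine integral_congr_ae ?_
    filter_upwards [ae_Y0_sub_Y hNoAnt hIFE hF hOm hg2 hgT ht 0] with ω hω
    by_cases hG : S.G 0 ω = g
    · have := hω hG.ge
      simp only [A, ind, hG, if_true, one_mul, one_smul, Y] at this ⊢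
      linear_combination -this
    · simp [A, ind, hG]
  have hNA : Integrable (fun ω => S.ind g 0 ω * (S.Y 0 t ω - S.Y 0 (g - 1) ω) -
      S.deltaStar Om t ⬝ᵥ S.A Om 0 ω) μ := hN.sub hdA
  rw [h1, h2, integral_sub hNA (S.integrable_ind_mul g 0 hv.integrable),
    integral_sub hN hdA, hv.2, sub_zero]
  congr 1
  simp only [dotProduct, EA]
  rw [integral_finsetSum _ fun j _ => (hA j).const_mul _]
  simp only [integral_const_mul]

/-! ### The influence function -/

/-- By the identification of `ATT(g,t)` the centring constants of the influence function cancel. -/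
lemma psi_eq {W : Matrix (S.comp μ t) (S.comp μ t) ℝ} (hp : 0 < S.p μ g)
    (hATT : S.p μ g * S.ATT μ g t =
      ∫ ω, S.ind g 0 ω * (S.Y 0 t ω - S.Y 0 (g - 1) ω) ∂μ - S.deltaStar Om t ⬝ᵥ S.EA μ Om)
    (i : ℕ) (ω : Ω) :
    S.psi μ Om t W i ω = (S.p μ g)⁻¹ * (S.ind g i ω * (S.Y i t ω - S.Y i (g - 1) ω) -
      (S.EA μ Om ᵥ* S.B μ Om t W) ⬝ᵥ (fun g' => S.ell μ t i ω g' * S.v Om t i ω) -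
      S.deltaStar Om t ⬝ᵥ S.A Om i ω - S.ATT μ g t * S.ind g i ω) := by
  simp only [psi, psi1, psi2, psi3, psi4, smul_dotProduct, dotProduct_sub, smul_eq_mul]
  rw [Matrix.dotProduct_mulVec]
  generalize (S.EA μ Om ᵥ* S.B μ Om t W) ⬝ᵥ (fun g' => S.ell μ t i ω g' * S.v Om t i ω) = c
  have hp' := hp.ne'
  field_simp
  linear_combination hATT

section

variable [IsProbabilityMeasure μ] {W : Matrix (S.comp μ t) (S.comp μ t) ℝ}

lemma isL2Statistic_psi (hIID : S.IIDSampling μ) (hNoAnt : S.NoAnticipation μ)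
    (hIFE : S.IFEModel μ) (hUnconf : S.Unconfoundedness μ) (hMoment : S.FiniteFourthMoment μ)
    (hF : S.RankFactors g) (hOm : S.AdmissibleOm Om) (hg2 : 2 ≤ g) (hgT : g ≤ T)
    (ht : t ∈ Finset.Icc 1 T) (hgt : g ≤ t) (hp : 0 < S.p μ g) :
    IsL2Statistic μ S.obs (S.psi μ Om t W) := by
  refine ((((isL2Statistic_ind_mul (S := S) g
    (isL2Statistic_Y_sub hIID hMoment hg2 hgT ht)).sub
    (IsL2Statistic.finset_sum Finset.univ fun g' _ => (isL2Statistic_ell_mul_v hIID hNoAnt hIFE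
      hMoment hF hOm hg2 hgT ht hgt g').const_mul ((S.EA μ Om ᵥ* S.B μ Om t W) g'))).sub
    (IsL2Statistic.finset_sum Finset.univ fun j _ =>
      (isL2Statistic_A hIID hMoment hgT Om j).const_mul (S.deltaStar Om t j))).sub
    ((isL2Statistic_ind S g).const_mul (S.ATT μ g t))).const_mul (S.p μ g)⁻¹ |>.congr
      fun i => Eventually.of_forall fun ω => ?_
  exact psi_eq hp (p_mul_ATT hIID hNoAnt hIFE hUnconf hMoment hF hOm hg2 hgT ht hp) i ω

lemma integral_psi (hIID : S.IIDSampling μ) (hNoAnt : S.NoAnticipation μ)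
    (hIFE : S.IFEModel μ) (hUnconf : S.Unconfoundedness μ) (hMoment : S.FiniteFourthMoment μ)
    (hF : S.RankFactors g) (hOm : S.AdmissibleOm Om) (hg2 : 2 ≤ g) (hgT : g ≤ T)
    (ht : t ∈ Finset.Icc 1 T) (hp : 0 < S.p μ g) :
    ∫ ω, S.psi μ Om t W 0 ω ∂μ = 0 := by
  have hATT := p_mul_ATT hIID hNoAnt hIFE hUnconf hMoment hF hOm hg2 hgT ht hp
  have hv := isGroupMeanZero_v (Om := Om) hIFE hUnconf hg2 hgT ht
  simp only [psi_eq hp hATT]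
  have hN : Integrable (fun ω => S.ind g 0 ω * (S.Y 0 t ω - S.Y 0 (g - 1) ω)) μ :=
    (isL2Statistic_ind_mul (S := S) g (isL2Statistic_Y_sub hIID hMoment hg2 hgT ht)).integrable
  have hA (j) := (isL2Statistic_A hIID hMoment hgT Om j).integrable
  have hdA : Integrable (fun ω => S.deltaStar Om t ⬝ᵥ S.A Om 0 ω) μ :=
    integrable_finsetSum _ fun j _ => (hA j).const_mul _
  have hU : Integrable (fun ω => (S.EA μ Om ᵥ* S.B μ Om t W) ⬝ᵥ
      fun g' => S.ell μ t 0 ω g' * S.v Om t 0 ω) μ :=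
    integrable_finsetSum _ fun g' _ => (integrable_ell_mul hv.integrable g').const_mul _
  have hI : Integrable (fun ω => S.ATT μ g t * S.ind g 0 ω) μ :=
    (isL2Statistic_ind S g).integrable.const_mul _
  have hU0 : ∫ ω, (S.EA μ Om ᵥ* S.B μ Om t W) ⬝ᵥ
      (fun g' => S.ell μ t 0 ω g' * S.v Om t 0 ω) ∂μ = 0 := by
    simp only [dotProduct]
    rw [integral_finsetSum _ fun g' _ => (integrable_ell_mul hv.integrable g').const_mul _]
    exact Finset.sum_eq_zero fun g' _ => by
      rw [integral_const_mul, integral_ell_mul_eq_zero hv, mul_zero]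
  have hdA' : ∫ ω, S.deltaStar Om t ⬝ᵥ S.A Om 0 ω ∂μ = S.deltaStar Om t ⬝ᵥ S.EA μ Om := by
    simp only [dotProduct, EA]
    rw [integral_finsetSum _ fun j _ => (hA j).const_mul _]
    simp only [integral_const_mul]
  rw [integral_const_mul, integral_sub (by exact (hN.sub hU).sub hdA) hI,
    integral_sub (by exact hN.sub hU) hdA, integral_sub hN hU, hU0, hdA', integral_const_mul,
    integral_ind, sub_zero, ← hATT, mul_comm (S.ATT μ g t), sub_self, mul_zero]

end

/-! ### Asymptotic linearity -/

lemma sampleMean_sub {Ω : Type*} (n : ℕ) (f f' : ℕ → Ω → ℝ) (ω : Ω) :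
    sampleMean n (fun i ω => f i ω - f' i ω) ω = sampleMean n f ω - sampleMean n f' ω := by
  simp only [sampleMean, Finset.sum_sub_distrib, mul_sub]

lemma sampleMean_const_mul {Ω : Type*} (n : ℕ) (c : ℝ) (f : ℕ → Ω → ℝ) (ω : Ω) :
    sampleMean n (fun i ω => c * f i ω) ω = c * sampleMean n f ω := by
  simp only [sampleMean, ← Finset.mul_sum, mul_left_comm]

lemma sampleMean_dotProduct {Ω ι : Type*} [Fintype ι] (n : ℕ) (c : ι → ℝ)
    (F : ℕ → Ω → ι → ℝ) (ω : Ω) : sampleMean n (fun i ω => c ⬝ᵥ F i ω) ω =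
      c ⬝ᵥ fun j => sampleMean n (fun i ω => F i ω j) ω := by
  simp only [sampleMean, dotProduct]
  rw [Finset.sum_comm, Finset.mul_sum]
  refine Finset.sum_congr rfl fun j _ => ?_
  rw [← Finset.mul_sum]
  ring

/-- For `n = 0` both sides vanish. -/
lemma sqrt_mul_sampleMean {Ω : Type*} (f : ℕ → Ω → ℝ) (x : ℕ × Ω) :
    √(x.1 : ℝ) * sampleMean x.1 f x.2 = normalizedSum f x := by
  rw [normalizedSum, sampleMean, ← mul_assoc, ← div_eq_mul_inv, Real.sqrt_div_self]

lemma aemeasurable_sampleMean {f : ℕ → Ω → ℝ} (hIID : S.IIDSampling μ)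
    (hf : IsL2Statistic μ S.obs f) (n : ℕ) : AEMeasurable (fun ω => sampleMean n f ω) μ :=
  (Finset.aemeasurable_fun_sum _ fun i _ => hf.aemeasurable hIID.2 i).const_mul _

/-- Whenever `Γ̂'ŴΓ̂` is invertible, `δ̂* - δ*` is the weighted least squares matrix applied to the
average of `ℓ^comp v`. -/
lemma ae_deltaHat_eq (hNoAnt : S.NoAnticipation μ) (hIFE : S.IFEModel μ) (hF : S.RankFactors g)
    (hOm : S.AdmissibleOm Om) (hg2 : 2 ≤ g) (hgT : g ≤ T) (ht : t ∈ Finset.Icc 1 T)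
    (hgt : g ≤ t) (What : ℕ → Ω → Matrix (S.comp μ t) (S.comp μ t) ℝ) (n : ℕ) :
    ∀ᵐ ω ∂μ, IsUnit ((S.GamHat μ Om t n ω)ᵀ * What n ω * S.GamHat μ Om t n ω).det →
      S.deltaHat μ Om t What n ω = S.deltaStar Om t +
        (((S.GamHat μ Om t n ω)ᵀ * What n ω * S.GamHat μ Om t n ω)⁻¹ *
          (S.GamHat μ Om t n ω)ᵀ * What n ω) *ᵥ
            fun g' => sampleMean n (fun i ω => S.ell μ t i ω g' * S.v Om t i ω) ω := by
  filter_upwards [ae_all_iff.2 fun i => ae_ell_mul_Y_sub hNoAnt hIFE hF hOm hg2 hgT ht hgt i]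
    with ω hω hdet
  -- by the estimating equation, `E_n[ℓ (Y_t - Y_{g-1})] = Γ̂ δ* + E_n[ℓ v]`
  rw [← weightedLeastSquares_mulVec hdet, deltaHat]
  congr 1
  ext g'
  have h1 : (S.GamHat μ Om t n ω *ᵥ S.deltaStar Om t) g' =
      sampleMean n (fun i ω => S.deltaStar Om t ⬝ᵥ (S.ell μ t i ω g' • S.regressor Om i ω)) ω := by
    rw [sampleMean_dotProduct, dotProduct_comm]
    rfl
  rw [Pi.add_apply, h1]
  simp only [sampleMean, hω, Finset.sum_add_distrib, mul_add, dotProduct_smul, smul_eq_mul]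

section

variable [IsProbabilityMeasure μ] {W : Matrix (S.comp μ t) (S.comp μ t) ℝ}
  {What : ℕ → Ω → Matrix (S.comp μ t) (S.comp μ t) ℝ}

lemma tendsto_GamHat (hIID : S.IIDSampling μ) (hMoment : S.FiniteFourthMoment μ) (hgT : g ≤ T) :
    Tendsto (fun x : ℕ × Ω => S.GamHat μ Om t x.1 x.2) (probFilter μ) (𝓝 (S.Gam μ Om t)) := by
  refine tendsto_matrix_of_entries fun g' j => ?_
  have h := tendsto_sampleMean
    (isL2Statistic_ell_mul g' (isL2Statistic_regressor hIID hMoment hgT Om j)) hIID.1 hIID.2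
  exact h

/-- The remainder of the linear expansion of the estimator is `o_p(1)`: it is a sum of estimation
errors of consistently estimated coefficients, each times a normalized sum that is bounded in
probability. -/
lemma tendsto_sqrt_mul_ATTHat_sub (hIID : S.IIDSampling μ) (hNoAnt : S.NoAnticipation μ)
    (hIFE : S.IFEModel μ) (hUnconf : S.Unconfoundedness μ) (hMoment : S.FiniteFourthMoment μ)
    (hF : S.RankFactors g) (hLam : S.RankLoadings μ t) (hOm : S.AdmissibleOm Om) (hg2 : 2 ≤ g)
    (hgT : g ≤ T) (ht : t ∈ Finset.Icc 1 T) (hgt : g ≤ t) (hp : 0 < S.p μ g) (hW : W.PosDef)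
    (hWhat : Tendsto (fun x : ℕ × Ω => What x.1 x.2) (probFilter μ) (𝓝 W)) :
    Tendsto (fun x : ℕ × Ω => √(x.1 : ℝ) * (S.ATTHat μ Om t What x.1 x.2 - S.ATT μ g t) -
      normalizedSum (S.psi μ Om t W) x) (probFilter μ) (𝓝 0) := by
  have hATT := p_mul_ATT hIID hNoAnt hIFE hUnconf hMoment hF hOm hg2 hgT ht hp
  have hv := isGroupMeanZero_v (Om := Om) hIFE hUnconf hg2 hgT ht
  have hdet := isUnit_det_transpose_mul_mul hW
    (Gam_mulVec_injective hIID hNoAnt hIFE hUnconf hMoment hF hLam hOm hgT hgt)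
  have hGam := tendsto_GamHat (t := t) (Om := Om) hIID hMoment hgT
  let Bh : ℕ × Ω → Matrix (Fin (R + 1)) (S.comp μ t) ℝ := fun x =>
    ((S.GamHat μ Om t x.1 x.2)ᵀ * What x.1 x.2 * S.GamHat μ Om t x.1 x.2)⁻¹ *
      (S.GamHat μ Om t x.1 x.2)ᵀ * What x.1 x.2
  let Ah : ℕ × Ω → Fin (R + 1) → ℝ := fun x j => sampleMean x.1 (fun i ω => S.A Om i ω j) x.2
  let ph : ℕ × Ω → ℝ := fun x => sampleMean x.1 (S.ind g) x.2
  let u : S.comp μ t → ℕ → Ω → ℝ := fun g' i ω => S.ell μ t i ω g' * S.v Om t i ω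
  let b : S.comp μ t → ℝ := S.EA μ Om ᵥ* S.B μ Om t W
  have hBh : Tendsto Bh (probFilter μ) (𝓝 (S.B μ Om t W)) :=
    tendsto_weightedLeastSquares hGam hWhat hdet
  have hAh (j : Fin (R + 1)) : Tendsto (fun x => Ah x j) (probFilter μ) (𝓝 (S.EA μ Om j)) :=
    tendsto_sampleMean (isL2Statistic_A hIID hMoment hgT Om j) hIID.1 hIID.2
  have hph : Tendsto ph (probFilter μ) (𝓝 (S.p μ g)) := by
    rw [← integral_ind]
    exact tendsto_sampleMean (isL2Statistic_ind S g) hIID.1 hIID.2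
  have hphinv := hph.inv₀ hp.ne'
  have hdet_ev : ∀ᶠ x in probFilter μ, IsUnit ((S.GamHat μ Om t x.1 x.2)ᵀ * What x.1 x.2 *
      S.GamHat μ Om t x.1 x.2).det := by
    have hc : Continuous fun M : Matrix (Fin (R + 1)) (Fin (R + 1)) ℝ => M.det := by fun_prop
    have h := (hc.tendsto _).comp (tendsto_transpose_mul_mul hGam hWhat)
    filter_upwards [h.eventually_ne hdet.ne_zero] with x hx
    exact isUnit_iff_ne_zero.2 hx
  have hδ_ev : ∀ᶠ x in probFilter μ, S.deltaHat μ Om t What x.1 x.2 =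
      S.deltaStar Om t + Bh x *ᵥ fun g' => sampleMean x.1 (u g') x.2 := by
    have h : ∀ᶠ x in probFilter μ, IsUnit ((S.GamHat μ Om t x.1 x.2)ᵀ * What x.1 x.2 *
        S.GamHat μ Om t x.1 x.2).det → S.deltaHat μ Om t What x.1 x.2 =
          S.deltaStar Om t + Bh x *ᵥ fun g' => sampleMean x.1 (u g') x.2 :=
      eventually_probFilter_of_ae (ae_deltaHat_eq hNoAnt hIFE hF hOm hg2 hgT ht hgt What)
    filter_upwards [hdet_ev, h] with x h1 h2
    exact h2 h1
  have hcoef : Tendsto (fun x => S.p μ g * (ph x)⁻¹ - 1) (probFilter μ) (𝓝 0) := by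
    have h := (hphinv.const_mul (S.p μ g)).sub_const 1
    rwa [mul_inv_cancel₀ hp.ne', sub_self] at h
  have hcoef' (g' : S.comp μ t) :
      Tendsto (fun x => (ph x)⁻¹ * (b g' - (Ah x ᵥ* Bh x) g')) (probFilter μ) (𝓝 0) := by
    have h : Tendsto (fun x => (Ah x ᵥ* Bh x) g') (probFilter μ) (𝓝 (b g')) := by
      simp only [b, Matrix.vecMul, dotProduct]
      exact tendsto_finsetSum _ fun j _ =>
        (hAh j).mul (tendsto_pi_nhds.1 (tendsto_pi_nhds.1 hBh j) g')
    have h' := hphinv.mul (h.const_sub (b g'))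
    rwa [sub_self, mul_zero] at h'
  have hψ := tendsto_mul_normalizedSum (isL2Statistic_psi (W := W) hIID hNoAnt hIFE hUnconf hMoment
    hF hOm hg2 hgT ht hgt hp) hIID.1 hIID.2
    (integral_psi hIID hNoAnt hIFE hUnconf hMoment hF hOm hg2 hgT ht hp) hcoef
  have hu (g' : S.comp μ t) := tendsto_mul_normalizedSum
    (isL2Statistic_ell_mul_v hIID hNoAnt hIFE hMoment hF hOm hg2 hgT ht hgt g') hIID.1 hIID.2
    (integral_ell_mul_eq_zero hv g') (hcoef' g')
  have hlim := hψ.add (tendsto_finsetSum Finset.univ fun g' _ => hu g')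
  simp only [Finset.sum_const_zero, add_zero] at hlim
  refine hlim.congr' ?_
  filter_upwards [hδ_ev, hph.eventually_ne hp.ne'] with x hδ hx
  have hp' := hp.ne'
  let U : S.comp μ t → ℝ := fun g' => sampleMean x.1 (u g') x.2
  -- from here on, the exact formula for the remainder on an event of probability tending to one
  have hψx : sampleMean x.1 (S.psi μ Om t W) x.2 = (S.p μ g)⁻¹ *
      (sampleMean x.1 (fun i ω => S.ind g i ω * (S.Y i t ω - S.Y i (g - 1) ω)) x.2 - b ⬝ᵥ U -
        S.deltaStar Om t ⬝ᵥ Ah x - S.ATT μ g t * ph x) := by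
    have : S.psi μ Om t W = fun i ω => (S.p μ g)⁻¹ *
        (S.ind g i ω * (S.Y i t ω - S.Y i (g - 1) ω) - b ⬝ᵥ (fun g' => u g' i ω) -
          S.deltaStar Om t ⬝ᵥ S.A Om i ω - S.ATT μ g t * S.ind g i ω) := by
      ext i ω
      exact psi_eq hp hATT i ω
    rw [this, sampleMean_const_mul, sampleMean_sub, sampleMean_sub, sampleMean_sub,
      sampleMean_dotProduct, sampleMean_dotProduct, sampleMean_const_mul]
  have hsum : ∑ g', (ph x)⁻¹ * (b g' - (Ah x ᵥ* Bh x) g') * normalizedSum (u g') x =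
      (ph x)⁻¹ * (√(x.1 : ℝ) * (b ⬝ᵥ U - Ah x ⬝ᵥ (Bh x *ᵥ U))) := by
    rw [Matrix.dotProduct_mulVec, ← sub_dotProduct]
    simp only [dotProduct, Finset.mul_sum, ← sqrt_mul_sampleMean, U, Pi.sub_apply]
    exact Finset.sum_congr rfl fun g' _ => by ring
  have hATTHat : S.ATTHat μ Om t What x.1 x.2 = (ph x)⁻¹ *
      (sampleMean x.1 (fun i ω => S.ind g i ω * (S.Y i t ω - S.Y i (g - 1) ω)) x.2 -
        Ah x ⬝ᵥ (S.deltaStar Om t + Bh x *ᵥ U)) := by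
    rw [ATTHat, hδ]
  refine (congrArg (_ + ·) hsum).trans ?_
  rw [hATTHat, dotProduct_add, dotProduct_comm (Ah x) (S.deltaStar Om t), ← sqrt_mul_sampleMean,
    hψx]
  field_simp
  ring

lemma aemeasurable_ATTHat (hIID : S.IIDSampling μ) (hMoment : S.FiniteFourthMoment μ)
    (hg2 : 2 ≤ g) (hgT : g ≤ T) (ht : t ∈ Finset.Icc 1 T)
    (hWhat : ∀ n a b, Measurable fun ω => What n ω a b) (n : ℕ) :
    AEMeasurable (S.ATTHat μ Om t What n) μ := by
  have hY := isL2Statistic_Y_sub hIID hMoment hg2 hgT ht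
  have hGam (g' : S.comp μ t) (j : Fin (R + 1)) :
      AEMeasurable (fun ω => S.GamHat μ Om t n ω g' j) μ :=
    aemeasurable_sampleMean hIID
      (isL2Statistic_ell_mul g' (isL2Statistic_regressor hIID hMoment hgT Om j)) n
  have hW (a b) : AEMeasurable (fun ω => What n ω a b) μ := (hWhat n a b).aemeasurable
  have hGW := aemeasurable_matrix_mul (M := fun ω => (S.GamHat μ Om t n ω)ᵀ)
    (fun j g' => hGam g' j) hW
  have hB := aemeasurable_matrix_mul (aemeasurable_matrix_mul
    (aemeasurable_matrix_inv (aemeasurable_matrix_mul hGW hGam))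
    (N := fun ω => (S.GamHat μ Om t n ω)ᵀ) fun j g' => hGam g' j) hW
  have hδ (j : Fin (R + 1)) : AEMeasurable (fun ω => S.deltaHat μ Om t What n ω j) μ := by
    simp only [deltaHat, Matrix.mulVec, dotProduct]
    exact Finset.aemeasurable_fun_sum _ fun g' _ => (hB j g').mul
      (aemeasurable_sampleMean hIID (isL2Statistic_ell_mul g' hY) n)
  refine (aemeasurable_sampleMean hIID (isL2Statistic_ind S g) n).inv.mul
    ((aemeasurable_sampleMean hIID (isL2Statistic_ind_mul (S := S) g hY) n).sub ?_)
  simp only [dotProduct]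
  exact Finset.aemeasurable_fun_sum _ fun j _ =>
    (aemeasurable_sampleMean hIID (isL2Statistic_A hIID hMoment hgT Om j) n).mul (hδ j)

end

end IFEPanel

/-! ### Consistency and asymptotic normality -/

theorem mainTheorem3 {Ω : Type*} [MeasurableSpace Ω] (μ : Measure Ω) [IsProbabilityMeasure μ]
    {R T : ℕ} (S : IFEPanel Ω R T)
    (hStaggered : S.StaggeredAdoption μ) (hNoAnt : S.NoAnticipation μ) (hIID : S.IIDSampling μ)
    (hIFE : S.IFEModel μ) (hUnconf : S.Unconfoundedness μ)
    (g t : ℕ) (hg : (g : ℕ∞) ∈ S.groupsDagger μ) (ht : t ∈ Finset.Icc g (S.tMax μ))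
    (hRankF : S.RankFactors g) (hRankLam : S.RankLoadings μ t)
    (Om : Matrix (Fin (g - 2)) (Fin R) ℝ) (hOm : S.AdmissibleOm Om)
    (hMoment : S.FiniteFourthMoment μ)
    (W : Matrix (S.comp μ t) (S.comp μ t) ℝ) (hW : W.PosDef)
    (What : ℕ → Ω → Matrix (S.comp μ t) (S.comp μ t) ℝ)
    (hWhat_meas : ∀ n a b, Measurable fun ω => What n ω a b)
    (hWhat : ∀ a b, TendstoInMeasure μ (fun n ω => What n ω a b) atTop fun _ => W a b) :
    -- the influence function has mean zero and finite second moment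
    (MemLp (S.psi μ Om t W 0) 2 μ ∧ ∫ ω, S.psi μ Om t W 0 ω ∂μ = 0) ∧
    -- (i) asymptotic linearity
    TendstoInMeasure μ
      (fun (n : ℕ) ω => √(n : ℝ) * (S.ATTHat μ Om t What n ω - S.ATT μ g t) -
        (√(n : ℝ))⁻¹ * ∑ i ∈ Finset.range n, S.psi μ Om t W i ω)
      atTop (fun _ => 0) ∧
    -- (ii) consistency
    TendstoInMeasure μ (S.ATTHat μ Om t What) atTop (fun _ => S.ATT μ g t) ∧
    -- (iii) asymptotic normality
    TendstoInDistribution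
      (fun (n : ℕ) ω => √(n : ℝ) * (S.ATTHat μ Om t What n ω - S.ATT μ g t))
      atTop id (fun _ => μ)
      (gaussianReal 0 (∫ ω, S.psi μ Om t W 0 ω ^ 2 ∂μ).toNNReal) := by
  obtain ⟨hgroup, hgR, -⟩ := Finset.mem_filter.1 hg
  have hg2 : 2 ≤ g := by
    have : R + 2 ≤ g := by exact_mod_cast hgR
    omega
  obtain ⟨hgt, htmax⟩ := Finset.mem_Icc.1 ht
  have htT : t ≤ T := htmax.trans IFEPanel.tMax_le
  have hgT : g ≤ T := hgt.trans htT
  have ht1 : t ∈ Finset.Icc 1 T := Finset.mem_Icc.2 ⟨by omega, htT⟩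
  have hp := IFEPanel.p_pos_of_mem_groups hgroup
  have hψ := IFEPanel.isL2Statistic_psi (W := W) hIID hNoAnt hIFE hUnconf hMoment hRankF hOm
    hg2 hgT ht1 hgt hp
  have hψ0 := IFEPanel.integral_psi (W := W) hIID hNoAnt hIFE hUnconf hMoment hRankF hOm
    hg2 hgT ht1 hp
  have hWhat' : Tendsto (fun x : ℕ × Ω => What x.1 x.2) (probFilter μ) (𝓝 W) :=
    tendsto_matrix_of_entries fun a b =>
      tendstoInMeasure_const_iff (f := fun n ω => What n ω a b) |>.1 (hWhat a b)
  have hlin := IFEPanel.tendsto_sqrt_mul_ATTHat_sub hIID hNoAnt hIFE hUnconf hMoment hRankF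
    hRankLam hOm hg2 hgT ht1 hgt hp hW hWhat'
  refine ⟨⟨hψ.memLp, hψ0⟩, tendstoInMeasure_const_iff.2 hlin, tendstoInMeasure_const_iff.2 ?_, ?_⟩
  · -- dividing the expansion by `√n` leaves an `o_p(1)` term and a normalized sum over `√n`
    have h := ((tendsto_inv_sqrt_probFilter.mul hlin).add (tendsto_mul_normalizedSum hψ hIID.1
      hIID.2 hψ0 tendsto_inv_sqrt_probFilter)).add_const (S.ATT μ g t)
    rw [mul_zero, add_zero, zero_add] at h
    refine h.congr' ?_
    filter_upwards [tendsto_fst_probFilter.eventually (eventually_gt_atTop 0)] with x hx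
    have hs : √(x.1 : ℝ) ≠ 0 := (Real.sqrt_pos.2 (by exact_mod_cast hx)).ne'
    field_simp
    ring
  · exact tendstoInDistribution_of_tendstoInMeasure_sub _ _
      (tendstoInDistribution_normalizedSum hψ hIID.1 hIID.2 hψ0)
      (tendstoInMeasure_const_iff.2 hlin) fun n =>
        .const_mul (.sub_const
          (IFEPanel.aemeasurable_ATTHat hIID hMoment hg2 hgT ht1 hWhat_meas n) _) _
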